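/- Let $k$ be an algebraically closed field of characteristic zero, let $h\ge 2$, and let $R=k[[x_1,\dots,x_h]]$. An Artinian local ring $(A,\mathfrak m)$ is called almost stretched if the minimal number of generators of $\mathfrak m^2$ is two, and Gorenstein if its socle $0:\mathfrak m$ is one-dimensional over $A/\mathfrak m$. For integers $s\ge t+1\ge 3$, the ring $R/I$ is of type $(s,t)$ if its Hilbert function $H(j)=\dim \mathfrak m^j/\mathfrak m^{j+1}$ satisfies $H(0)=1$, $H(1)=h$, $H(j)=2$ for $2\le j\le t$, $H(j)=1$ for $t+1\le j\le s$, and $H(j)=0$ for $j>s$. For an integer $p\ge 0$ and $z\in R$ let $I_{p,z}$ be the ideal of $R$ generated by $$x_ix_j\ \ (1\le i<j\le h,\ (i,j)\ne(1,2)),\qquad x_j^2-x_1^s\ \ (3\le j\le h),\qquad x_2^2-x_1^{p+1}x_2-z\,x_1^{s-t+1},\qquad x_1^t x_2 .$$ Two ideals $I,J$ of $R$ are called isomorphic if $R/I$ and $R/J$ are isomorphic as $k$-algebras. The couple $(s,t)$ is called regular if there is no integer $r$ with $0\le r\le t-2$ and $2(r+1)=s-t+1$. Theorem 2.6. Let $I$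 be an ideal of $R$ such that $R/I$ is almost stretched and Gorenstein of type $(s,t)$, with $s\ge 2t-1$. (1) If $(s,t)$ is regular, then $I$ is isomorphic to one of the ideals $I_{0,1},I_{1,1},\dots,I_{t-1,1}$. (2) If $(s,t)$ is not regular and $r$ is the integer with $0\le r\le t-2$ and $2(r+1)=s-t+1$, then $I$ is isomorphic to one of the following ideals: $I_{p,1}$ with $0\le p\le t-1$ and $p\ne r$; $I_{r,c}$ with $c\in k^*$; or $I_{r,c+x_1^d}$ with $c\in k^*$ and $1\le d\le t-r-2$ (there are no ideals of the last kind if $r=t-2$). -/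

import Mathlib

open IsLocalRing

/-- The Hilbert function of a local ring `A` with maximal ideal `m`:
`H_A(j) = dim_{A/m} m^j / m^{j+1}`, where `m^{j+1}` is the submodule `m • m^j` of `m^j`. -/
noncomputable def hilbertFn (A : Type*) [CommRing A] [IsLocalRing A] (j : ℕ) : ℕ :=
  Module.finrank (A ⧸ maximalIdeal A)
    (↥(maximalIdeal A ^ j) ⧸ (maximalIdeal A • (⊤ : Submodule A ↥(maximalIdeal A ^ j))))

/-- A local ring is almost stretched if it is Artinian and the minimal number of generators of
the square of its maximal ideal is two. -/
def IsAlmostStretched (A : Type*) [CommRing A] [IsLocalRing A] : Prop :=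
  IsArtinianRing A ∧ (maximalIdeal A ^ 2).spanFinrank = 2

/-- The socle `0 : m` of a local ring `A` with maximal ideal `m`. -/
def localSocle (A : Type*) [CommRing A] [IsLocalRing A] : Ideal A where
  carrier := {a | ∀ b ∈ maximalIdeal A, b * a = 0}
  add_mem' := by
    intro a a' ha ha' b hb
    rw [mul_add, ha b hb, ha' b hb, add_zero]
  zero_mem' := by
    intro b _
    exact mul_zero b
  smul_mem' := by
    intro c a ha b hb
    rw [smul_eq_mul, mul_left_comm, ha b hb, mul_zero]

/-- An Artinian local ring is Gorenstein if its socle is one-dimensional over the residue field,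
that is, a simple module (the socle is killed by the maximal ideal). -/
def IsArtinianGorenstein (A : Type*) [CommRing A] [IsLocalRing A] : Prop :=
  IsArtinianRing A ∧ IsSimpleModule A ↥(localSocle A)

/-- The local ring `A` is of type `(s, t)`, with embedding dimension `h`: its Hilbert function is
`(1, h, 2, …, 2, 1, …, 1)`, with last `2` in degree `t` and last `1` in degree `s`, where
`s ≥ t + 1 ≥ 3` and `h ≥ 2`. -/
structure HasType (A : Type*) [CommRing A] [IsLocalRing A] (h s t : ℕ) : Prop where
  two_le_h : 2 ≤ h
  three_le : 3 ≤ t + 1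
  t_lt_s : t + 1 ≤ s
  deg_zero : hilbertFn A 0 = 1
  deg_one : hilbertFn A 1 = h
  deg_two : ∀ j, 2 ≤ j → j ≤ t → hilbertFn A j = 2
  deg_high : ∀ j, t + 1 ≤ j → j ≤ s → hilbertFn A j = 1
  deg_zero_of_gt : ∀ j, s < j → hilbertFn A j = 0

/-- `r` is an integer with `0 ≤ r ≤ t - 2` and `2 (r + 1) = s - t + 1`
(written without subtraction). -/
def IsCritical (s t r : ℕ) : Prop :=
  r + 2 ≤ t ∧ 2 * (r + 1) + t = s + 1

/-- The couple `(s, t)` is regular if there is no integer `r` with `0 ≤ r ≤ t - 2` and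
`2 (r + 1) = s - t + 1`. -/
def IsRegularCouple (s t : ℕ) : Prop :=
  ¬ ∃ r : ℕ, IsCritical s t r

section Models

variable {k : Type*} [Field k] {h : ℕ}

/-- The first variable `x_1` of `k[[x_1, …, x_h]]`; the index `i ∈ {1, …, h}` of the mathematical
notation is the element `i - 1` of `Fin h`. -/
noncomputable def x₁ (k : Type*) [Field k] {h : ℕ} (hh : 2 ≤ h) : MvPowerSeries (Fin h) k :=
  MvPowerSeries.X ⟨0, by omega⟩

/-- The second variable `x_2` of `k[[x_1, …, x_h]]`. -/
noncomputable def x₂ (k : Type*) [Field k] {h : ℕ} (hh : 2 ≤ h) : MvPowerSeries (Fin h) k :=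
  MvPowerSeries.X ⟨1, by omega⟩

/-- The ideal `I_{p,z}` of `k[[x_1, …, x_h]]` generated by
* `x_i x_j` for `1 ≤ i < j ≤ h`, `(i, j) ≠ (1, 2)`,
* `x_j ^ 2 - x_1 ^ s` for `3 ≤ j ≤ h`,
* `x_2 ^ 2 - x_1 ^ (p + 1) x_2 - z x_1 ^ (s - t + 1)`,
* `x_1 ^ t x_2`.

It is used only for `s ≥ t + 1`, where `s - t` is the true difference. -/
noncomputable def modelIdeal (hh : 2 ≤ h) (s t p : ℕ) (z : MvPowerSeries (Fin h) k) :
    Ideal (MvPowerSeries (Fin h) k) :=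
  Ideal.span
    ({f | ∃ i j : Fin h, i < j ∧ ¬ (i.val = 0 ∧ j.val = 1) ∧
        f = MvPowerSeries.X i * MvPowerSeries.X j} ∪
     {f | ∃ j : Fin h, 2 ≤ j.val ∧ f = MvPowerSeries.X j ^ 2 - x₁ k hh ^ s} ∪
     {x₂ k hh ^ 2 - x₁ k hh ^ (p + 1) * x₂ k hh - z * x₁ k hh ^ (s - t + 1),
      x₁ k hh ^ t * x₂ k hh})

/-- Two ideals `I`, `J` of `R = k[[x_1, …, x_h]]` are isomorphic, `I ∼ J`, if `R / I` and `R / J`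
are isomorphic `k`-algebras. -/
def IdealIso (I J : Ideal (MvPowerSeries (Fin h) k)) : Prop :=
  Nonempty ((MvPowerSeries (Fin h) k ⧸ I) ≃ₐ[k] (MvPowerSeries (Fin h) k ⧸ J))

end Models

/-!
The classification works inside the Artinian algebra `A = R / I`, with maximal ideal `m`. It looks
for elements of `A` that satisfy the relations of a model ideal and then compares dimensions.

By polarization some `l ∈ m` has `l ^ s ≠ 0`. A generic modification yields `x`, `y` with
`m ^ 2 = (x ^ 2, x y)`, and as `m ^ (t + 1) = (x ^ (t + 1))`, a change of `y` gives `x ^ t y = 0`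
(`exists_isFrame`). Hence `m ^ 2 = x (x, y)`, and every element of `m` is, modulo `(x, y)`,
annihilated by `x`; so membership in the socle is easy to test. As the socle is `k x ^ s`, the
element `x ^ (t - 1) y ^ 2` is a nonzero multiple of `x ^ s`, and the expansion of `y ^ 2` must be
`y ^ 2 = x g(x) y + w(x) x ^ (s - t + 1)` with `w(x)` a unit (`IsFrame.exists_sq_eq`).

If `x g(x) y ≠ 0`, write `g = x ^ p u` with `u` a unit and `p ≤ t - 2`. Rescaling `x` and `y` by units
of `k[x]`, which have all roots because `k` is algebraically closed of characteristic zero, makes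
`u = w = 1`, unless `2 (p + 1) = s - t + 1`. In that critical case `w / u ^ 2` is an invariant, up to
re-expressing it in the new `x` and up to terms of order `t - p - 1`, since `x ^ t y = 0`. It is
brought to the form `c` or `c + x ^ d` (`IsFrame.exists_isNormalFrame`). If `x g(x) y = 0`, scaling
`x` alone suffices, with `p = t - 1`.

The elements of `m` annihilated by `x` and `y` multiply into the socle, so they carry a symmetric
bilinear form whose radical is the socle; an orthonormal family modulo the socle supplies the
remaining variables (`IsFrame.exists_isOrthonormalComplement`), and its size is read off from
`A / m ^ 2`.

Finally the model algebra surjects onto `A`. The relations show that it is spanned by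
`x ^ i` (`i ≤ s`), `x ^ i y` (`i < t`) and the other variables, which are as many as the Hilbert
function gives for `dim A`; so the surjection is an isomorphism (`idealIso_modelIdeal`).
-/

/-! ### Local algebras with residue field `k` -/

section LocalAlgebra

variable {k A : Type*} [Field k] [CommRing A] [Algebra k A]

/-- A `k`-subspace that contains `1` and is stable under multiplication by generators of a nilpotent
ideal `m` with `A = k + m` is everything. It serves both to bound dimensions and to prove
surjectivity. -/
theorem eq_top_of_mul_generators_mem {ι : Type*} [Fintype ι] (g : ι → A) (m : Ideal A) {N : ℕ}
    (hN : m ^ N = ⊥) (hg : ∀ i, g i ∈ m)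
    (hA : ∀ a : A, ∃ (c : k) (b : ι → A), a = algebraMap k A c + ∑ i, b i * g i)
    (S : Submodule k A) (h1 : (1 : A) ∈ S) (hS : ∀ a ∈ S, ∀ i, a * g i ∈ S) : S = ⊤ := by
  have key : ∀ (n : ℕ) (a : A), ∃ u ∈ S, a - u ∈ m ^ n := by
    intro n
    induction n with
    | zero => exact fun a => ⟨0, S.zero_mem, by simp⟩
    | succ n ih =>
      intro a
      obtain ⟨c, b, hb⟩ := hA a
      choose u hu hum using ih
      refine ⟨algebraMap k A c + ∑ i, u (b i) * g i, S.add_mem ?_ (S.sum_mem fun i _ =>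
        hS _ (hu _) i), ?_⟩
      · rw [Algebra.algebraMap_eq_smul_one]
        exact S.smul_mem _ h1
      · have : a - (algebraMap k A c + ∑ i, u (b i) * g i) = ∑ i, (b i - u (b i)) * g i := by
          nth_rewrite 1 [hb]
          simp only [sub_mul, Finset.sum_sub_distrib]
          ring
        rw [this, pow_succ]
        exact Ideal.sum_mem _ fun i _ => Ideal.mul_mem_mul (hum _) (hg i)
  rw [eq_top_iff]
  rintro a -
  obtain ⟨u, hu, hau⟩ := key N a
  rw [hN, Ideal.mem_bot, sub_eq_zero] at hau
  rwa [hau]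

variable [IsLocalRing A]

/-- `hilbertFn` is a dimension over `A / m`; as `A / m = k`, it is the drop of the `k`-dimension from
`m ^ j` to `m ^ (j + 1)`. -/
theorem finrank_pow_eq_hilbertFn_add
    (hres : ∀ a : A, ∃ c : k, a - algebraMap k A c ∈ maximalIdeal A) [Module.Finite k A] (j : ℕ) :
    Module.finrank k ((maximalIdeal A ^ j).restrictScalars k) =
      hilbertFn A j + Module.finrank k ((maximalIdeal A ^ (j + 1)).restrictScalars k) := by
  set m := maximalIdeal A
  let N : Submodule A ↥(m ^ j) := m • ⊤
  have hfin : Module.Finite k ↥(m ^ j) :=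
    inferInstanceAs (Module.Finite k ((m ^ j).restrictScalars k))
  have h1 := Submodule.finrank_quotient_add_finrank (N.restrictScalars k)
  have h2 : Module.finrank k (N.restrictScalars k) =
      Module.finrank k ((m ^ (j + 1)).restrictScalars k) := by
    have hmap : (N.restrictScalars k).map ((m ^ j).subtype.restrictScalars k) =
        (m ^ (j + 1)).restrictScalars k := by
      have : N.map (m ^ j).subtype = m ^ (j + 1) := by
        rw [Submodule.map_smul'', Submodule.map_top, Submodule.range_subtype, smul_eq_mul,
          pow_succ']
      rw [← this]; rfl
    rw [← hmap]
    exact (Submodule.equivMapOfInjective ((m ^ j).subtype.restrictScalars k)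
      Subtype.val_injective _).finrank_eq
  have h3 : Module.finrank k (↥(m ^ j) ⧸ N.restrictScalars k) = hilbertFn A j := by
    unfold hilbertFn
    refine congrArg Cardinal.toNat ?_
    refine rank_eq_of_equiv_equiv (algebraMap k (A ⧸ m)) (AddEquiv.refl (↥(m ^ j) ⧸ N)) ?_ ?_
    · refine ⟨(algebraMap k (A ⧸ m)).injective, fun a => ?_⟩
      obtain ⟨a, rfl⟩ := Ideal.Quotient.mk_surjective a
      obtain ⟨c, hc⟩ := hres a
      exact ⟨c, (Ideal.Quotient.eq.2 hc).symm⟩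
    · intro c v
      obtain ⟨v, rfl⟩ := Submodule.Quotient.mk_surjective _ v
      exact congrArg (Submodule.Quotient.mk (p := N)) (algebraMap_smul A c v).symm
  have h4 : Module.finrank k ((m ^ j).restrictScalars k) = Module.finrank k ↥(m ^ j) := rfl
  omega

theorem moduleFinite_of_residue_surjective [IsArtinianRing A]
    (hres : ∀ a : A, ∃ c : k, a - algebraMap k A c ∈ maximalIdeal A) : Module.Finite k A := by
  obtain ⟨N, hN⟩ := (isArtinianRing_iff_isNilpotent_maximalIdeal A).mp ‹_›
  obtain ⟨n, g, hg⟩ := Submodule.fg_iff_exists_fin_generating_family.1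
    (IsNoetherian.noetherian (maximalIdeal A))
  have hgm : ∀ i, g i ∈ maximalIdeal A := fun i => hg ▸ Submodule.subset_span ⟨i, rfl⟩
  have hA : ∀ a : A, ∃ (c : k) (b : Fin n → A), a = algebraMap k A c + ∑ i, b i * g i := by
    intro a
    obtain ⟨c, hc⟩ := hres a
    rw [← hg, Submodule.mem_span_range_iff_exists_fun] at hc
    obtain ⟨b, hb⟩ := hc
    exact ⟨c, b, by simp only [smul_eq_mul] at hb; rw [hb]; ring⟩
  have htop := eq_top_of_mul_generators_mem g _ hN hgm hA
    (Subalgebra.toSubmodule (Algebra.adjoin k (Set.range g))) (one_mem (Algebra.adjoin k _))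
    fun a ha i => mul_mem (S := Subalgebra k A) ha (Algebra.subset_adjoin ⟨i, rfl⟩)
  have hint : ∀ a ∈ Set.range g, IsIntegral k a := by
    rintro _ ⟨i, rfl⟩
    exact IsIntegral.of_pow (n := N + 1) (by omega) <| by
      rw [show g i ^ (N + 1) = 0 from by
        have := Ideal.pow_mem_pow (hgm i) N
        rw [hN] at this
        rw [pow_succ, (Ideal.mem_bot).1 this, zero_mul]]
      exact isIntegral_zero
  have := fg_adjoin_of_finite (Set.finite_range g) hint
  rw [htop] at this
  exact ⟨this⟩

end LocalAlgebra

/-! ### Powers of elements over an infinite field -/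

section PolynomialVanishing

variable {k A : Type*} [Field k] [Infinite k] [CommRing A] [Algebra k A]

open Polynomial in
/-- Although `A` need not be a domain, a polynomial over `A` vanishing on the infinite field `k` is
zero: apply the linear functionals of `A` to its coefficients. -/
theorem Polynomial.eq_zero_of_eval_algebraMap_eq_zero (P : A[X])
    (hP : ∀ c : k, P.eval (algebraMap k A c) = 0) : P = 0 := by
  ext n
  rw [coeff_zero, ← Module.forall_dual_apply_eq_zero_iff k]
  intro f
  let Q : k[X] := ∑ i ∈ P.support, monomial i (f (P.coeff i))
  have hQ : Q = 0 := by
    refine Polynomial.funext fun c => ?_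
    have := congrArg f (hP c)
    rw [eval_eq_sum, Polynomial.sum, map_sum, map_zero] at this
    rw [eval_finsetSum, eval_zero, ← this]
    refine Finset.sum_congr rfl fun i _ => ?_
    rw [eval_monomial, ← map_pow, mul_comm (P.coeff i), ← Algebra.smul_def, map_smul, smul_eq_mul,
      mul_comm]
  have hc : Q.coeff n = f (P.coeff n) := by
    simp only [Q, finsetSum_coeff, coeff_monomial]
    rw [Finset.sum_ite_eq']
    split_ifs with hn
    · rfl
    · rw [notMem_support_iff.1 hn, map_zero]
  rw [← hc, hQ, coeff_zero]

open Polynomial in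
theorem exists_ne_zero_add_smul_pow_ne_zero {l : A} (v : A) {s : ℕ} (hl : l ^ s ≠ 0) :
    ∃ c : k, c ≠ 0 ∧ (l + c • v) ^ s ≠ 0 := by
  by_contra! H
  have := Polynomial.eq_zero_of_eval_algebraMap_eq_zero (k := k) (X * (C l + X * C v) ^ s) (by
    intro c
    rcases eq_or_ne c 0 with rfl | hc
    · simp
    · have := H c hc
      rw [Algebra.smul_def, mul_comm] at this
      simp [this])
  have h1 := congrArg (fun P : A[X] => P.coeff 1) this
  simp only [coeff_X_mul, coeff_zero, coeff_zero_eq_eval_zero] at h1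
  exact hl (by simpa using h1)

open Polynomial in
/-- Polarization step: differentiate `ε ↦ (l + ε v) ^ (n + 1) * w` at `ε = 0`. -/
theorem pow_mul_mul_eq_zero_of_forall_pow_succ_mul [CharZero k] (m : Ideal A) {n : ℕ} {w : A}
    (H : ∀ l ∈ m, l ^ (n + 1) * w = 0) {l v : A} (hl : l ∈ m) (hv : v ∈ m) :
    l ^ n * (v * w) = 0 := by
  have := Polynomial.eq_zero_of_eval_algebraMap_eq_zero (k := k)
    ((C l + X * C v) ^ (n + 1) * C w) (by
      intro c
      simpa using H _ (m.add_mem hl (m.mul_mem_right (algebraMap k A c) hv)))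
  have h1 := congrArg (fun P : A[X] => P.derivative.eval 0) this
  simp [derivative_pow] at h1
  have h2 : ((n + 1 : k)) • (l ^ n * (v * w)) = 0 := by
    rw [Algebra.smul_def]
    simp only [map_add, map_natCast, map_one]
    linear_combination h1
  exact (smul_eq_zero.1 h2).resolve_left (by exact_mod_cast Nat.succ_ne_zero n)

theorem exists_pow_ne_zero_of_ideal_pow_ne_bot (k : Type*) {A : Type*} [Field k] [CharZero k]
    [CommRing A] [Algebra k A] (m : Ideal A) {s : ℕ}
    (hs : m ^ s ≠ ⊥) : ∃ l ∈ m, l ^ s ≠ 0 := by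
  by_contra! H
  have key : ∀ j ≤ s, ∀ w ∈ m ^ j, ∀ l ∈ m, l ^ (s - j) * w = 0 := by
    intro j
    induction j with
    | zero => intro _ w _ l hl; simp [H l hl]
    | succ j ih =>
      intro hj w hw l hl
      rw [pow_succ'] at hw
      refine Submodule.mul_induction_on hw (fun v hv w hw => ?_) (fun a b ha hb => by
        rw [mul_add, ha, hb, add_zero])
      refine pow_mul_mul_eq_zero_of_forall_pow_succ_mul (k := k) m (fun l hl => ?_) hl hv
      rw [show s - (j + 1) + 1 = s - j by omega]
      exact ih (by omega) w hw l hl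
  refine hs (eq_bot_iff.2 fun w hw => ?_)
  simpa using key s le_rfl w hw 0 m.zero_mem

end PolynomialVanishing

/-! ### Frames: generators of the square of the maximal ideal -/

section Frame

theorem Submodule.le_sup_span_singleton {k M : Type*} [Field k] [AddCommGroup M] [Module k M]
    [Module.Finite k M] {W V : Submodule k M} (hWV : W ≤ V)
    (hfin : Module.finrank k V ≤ Module.finrank k W + 1) {a : M} (ha : a ∈ V) (haW : a ∉ W) :
    V ≤ W ⊔ Submodule.span k {a} := by
  have hle : W ⊔ Submodule.span k {a} ≤ V :=
    sup_le hWV ((Submodule.span_singleton_le_iff_mem _ _).2 ha)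
  have hlt : W < W ⊔ Submodule.span k {a} := lt_of_le_of_ne le_sup_left fun h =>
    haW (h ▸ Submodule.mem_sup_right (Submodule.mem_span_singleton_self a))
  have := Submodule.finrank_lt_finrank_of_lt hlt
  exact (Submodule.eq_of_le_of_finrank_le hle (by omega)).ge

theorem Submodule.le_sup_span_singleton_sup_span_singleton {k M : Type*} [Field k]
    [AddCommGroup M] [Module k M] [Module.Finite k M] {W V : Submodule k M} (hWV : W ≤ V)
    (hfin : Module.finrank k V ≤ Module.finrank k W + 2) {a b : M} (ha : a ∈ V) (haW : a ∉ W)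
    (hb : b ∈ V) (hbW : b ∉ W ⊔ Submodule.span k {a}) :
    V ≤ W ⊔ Submodule.span k {a} ⊔ Submodule.span k {b} := by
  have hlt : W < W ⊔ Submodule.span k {a} := lt_of_le_of_ne le_sup_left fun h =>
    haW (h ▸ Submodule.mem_sup_right (Submodule.mem_span_singleton_self a))
  have := Submodule.finrank_lt_finrank_of_lt hlt
  exact Submodule.le_sup_span_singleton
    (sup_le hWV ((Submodule.span_singleton_le_iff_mem _ _).2 ha)) (by omega) hb hbW

/-- A frame of a local ring of type `(s, t)`: elements `x`, `y` of the maximal ideal `m` such that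
`x ^ 2`, `x y` generate `m ^ 2`, normalized by `x ^ t y = 0`. The element `x ^ s` is then nonzero in
the last nonzero power of `m`, and `x ^ (t - 1) y` is a new class in degree `t`. -/
structure IsFrame {A : Type*} [CommRing A] [IsLocalRing A] (s t : ℕ) (x y : A) : Prop where
  left_mem : x ∈ maximalIdeal A
  right_mem : y ∈ maximalIdeal A
  sq_eq : maximalIdeal A ^ 2 = Ideal.span {x ^ 2, x * y}
  pow_ne_zero : x ^ s ≠ 0
  pow_eq_bot : maximalIdeal A ^ (s + 1) = ⊥
  pow_mul_eq_zero : x ^ t * y = 0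
  pow_mul_notMem : x ^ (t - 1) * y ∉ maximalIdeal A ^ (t + 1)

variable {k A : Type*} [Field k] [CommRing A] [Algebra k A] [IsLocalRing A]

/-- If `m ^ 2 = x (x, y)`, then `m ^ (j + 2) = x ^ (j + 1) (x, y)` in every degree. -/
theorem maximalIdeal_pow_eq {x y : A} (hx : x ∈ maximalIdeal A) (hy : y ∈ maximalIdeal A)
    (hsq : maximalIdeal A ^ 2 = Ideal.span {x ^ 2, x * y}) (j : ℕ) :
    maximalIdeal A ^ (j + 2) = Ideal.span {x ^ (j + 2), x ^ (j + 1) * y} := by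
  induction j with
  | zero => simpa using hsq
  | succ j ih =>
    apply le_antisymm
    · have key : ∀ b ∈ maximalIdeal A ^ 2,
          x ^ (j + 1) * b ∈ Ideal.span {x ^ (j + 2 + 1), x ^ (j + 1 + 1) * y} := by
        intro b hb
        rw [hsq, Ideal.mem_span_pair] at hb
        obtain ⟨c, d, rfl⟩ := hb
        exact Ideal.mem_span_pair.2 ⟨c, d, by ring⟩
      rw [show j + 1 + 2 = (j + 2) + 1 by ring, pow_succ, Ideal.mul_le]
      intro r hr z hz
      rw [ih, Ideal.mem_span_pair] at hr
      obtain ⟨c, d, rfl⟩ := hr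
      have hmem : (c * x + d * y) * z ∈ maximalIdeal A ^ 2 := by
        rw [pow_two]
        exact Ideal.mul_mem_mul (add_mem (Ideal.mul_mem_left _ _ hx) (Ideal.mul_mem_left _ _ hy)) hz
      convert key _ hmem using 1
      ring
    · rw [Ideal.span_le]
      rintro _ (rfl | rfl)
      · exact Ideal.pow_mem_pow hx _
      · rw [show j + 1 + 2 = (j + 2) + 1 by ring, pow_succ]
        exact Ideal.mul_mem_mul (Ideal.pow_mem_pow hx _) hy

omit [IsLocalRing A] in
theorem pow_notMem_of_pow_ne_zero {m : Ideal A} {x : A} {s : ℕ} (hbot : m ^ (s + 1) = ⊥)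
    (hx : x ∈ m) (hs : x ^ s ≠ 0) {j : ℕ} (hj : j ≤ s) : x ^ j ∉ m ^ (j + 1) := by
  intro h
  have : x ^ j * x ^ (s - j) ∈ m ^ (j + 1) * m ^ (s - j) :=
    Ideal.mul_mem_mul h (Ideal.pow_mem_pow hx _)
  rw [← pow_add, ← pow_add, show j + 1 + (s - j) = s + 1 by omega,
    show j + (s - j) = s by omega, hbot] at this
  exact hs this

/-- If `l` multiplies the maximal ideal onto `m ^ 2` modulo `m ^ 3`, take `x = l`. Otherwise `l m` is
contained in the line `k l ^ 2` modulo `m ^ 3`, some `v` with `l v ∈ m ^ 3` has its square off this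
line, and `x = l + ε v`, `y = v` work for suitable `ε ≠ 0`. -/
theorem exists_sq_le_sup [Infinite k] (h2k : (2 : k) ≠ 0) [Module.Finite k A]
    (hfin : Module.finrank k ((maximalIdeal A ^ 2).restrictScalars k) =
      Module.finrank k ((maximalIdeal A ^ 3).restrictScalars k) + 2) {s : ℕ} (hs : 2 ≤ s)
    (hbot : maximalIdeal A ^ (s + 1) = ⊥) {l : A} (hl : l ∈ maximalIdeal A) (hls : l ^ s ≠ 0) :
    ∃ x ∈ maximalIdeal A, ∃ y ∈ maximalIdeal A, x ^ s ≠ 0 ∧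
      maximalIdeal A ^ 2 ≤ Ideal.span {x ^ 2, x * y} ⊔ maximalIdeal A ^ 3 := by
  set m := maximalIdeal A with hm
  have hle : (m ^ 3).restrictScalars k ≤ (m ^ 2).restrictScalars k :=
    Ideal.pow_le_pow_right (by norm_num)
  have hsqmem : ∀ {a b : A}, a ∈ m → b ∈ m → a * b ∈ m ^ 2 := fun ha hb => by
    rw [pow_two]; exact Ideal.mul_mem_mul ha hb
  have hl2 : l ^ 2 ∉ m ^ 3 := pow_notMem_of_pow_ne_zero hbot hl hls hs
  let L : Submodule k A := (m ^ 3).restrictScalars k ⊔ Submodule.span k {l ^ 2}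
  have hL : ∀ b ∈ m ^ 2, b ∉ L → ∀ w ∈ m ^ 2, ∃ u ∈ m ^ 3, ∃ c d : k, w = u + c • l ^ 2 + d • b := by
    intro b hb hbL w hw
    have := Submodule.le_sup_span_singleton_sup_span_singleton hle hfin.le
      (show l ^ 2 ∈ (m ^ 2).restrictScalars k from Ideal.pow_mem_pow hl 2) hl2
      (show b ∈ (m ^ 2).restrictScalars k from hb) hbL (show w ∈ (m ^ 2).restrictScalars k from hw)
    obtain ⟨v, hv, d', hd, rfl⟩ := Submodule.mem_sup.1 this
    obtain ⟨u, hu, c', hc, rfl⟩ := Submodule.mem_sup.1 hv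
    obtain ⟨c, rfl⟩ := Submodule.mem_span_singleton.1 hc
    obtain ⟨d, rfl⟩ := Submodule.mem_span_singleton.1 hd
    exact ⟨u, hu, c, d, rfl⟩
  by_cases hcase : ∃ y ∈ m, l * y ∉ L
  · obtain ⟨y, hy, hyL⟩ := hcase
    refine ⟨l, hl, y, hy, hls, fun w hw => ?_⟩
    obtain ⟨u, hu, c, d, rfl⟩ := hL _ (hsqmem hl hy) hyL w hw
    rw [add_assoc, add_comm u]
    refine Submodule.add_mem_sup (Ideal.mem_span_pair.2
      ⟨algebraMap k A c, algebraMap k A d, ?_⟩) hu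
    rw [Algebra.smul_def, Algebra.smul_def]
  push Not at hcase
  obtain ⟨v₀, hv₀, hv₀L⟩ : ∃ v ∈ m, v ^ 2 ∉ L := by
    by_contra! H
    have hm2 : (m ^ 2).restrictScalars k ≤ L := by
      intro w hw
      change w ∈ m ^ 2 at hw
      rw [pow_two] at hw
      refine Submodule.mul_induction_on hw (fun a ha b hb => ?_) (fun a b ha hb => L.add_mem ha hb)
      have h4 := L.sub_mem (L.sub_mem (H _ (m.add_mem ha hb)) (H _ ha)) (H _ hb)
      have h5 := L.smul_mem (2⁻¹ : k) h4
      rwa [show (a + b) ^ 2 - a ^ 2 - b ^ 2 = (2 : k) • (a * b) by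
        rw [ofNat_smul_eq_nsmul, nsmul_eq_mul]; push_cast; ring, inv_smul_smul₀ h2k] at h5
    have h6 := Submodule.finrank_mono hm2
    have h7 := Submodule.finrank_add_le_finrank_add_finrank ((m ^ 3).restrictScalars k)
      (Submodule.span k {l ^ 2})
    have h8 : Module.finrank k (Submodule.span k {l ^ 2}) ≤ 1 := by
      simpa using finrank_span_le_card (R := k) {l ^ 2}
    have h9 : Module.finrank k L = Module.finrank k
      ↥((m ^ 3).restrictScalars k ⊔ Submodule.span k {l ^ 2}) := rfl
    omega
  obtain ⟨u₀, hu₀, e, he, huv⟩ := Submodule.mem_sup.1 (hcase v₀ hv₀)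
  obtain ⟨a, rfl⟩ := Submodule.mem_span_singleton.1 he
  -- Subtracting a multiple of `l` makes `l * v` vanish to order three.
  set v := v₀ - a • l with hvdef
  have hv : v ∈ m := m.sub_mem hv₀ ((m.restrictScalars k).smul_mem a hl)
  have hlv : l * v = u₀ := by
    rw [hvdef, mul_sub, ← huv, mul_smul_comm, ← pow_two, add_sub_cancel_right]
  have hv2 : v ^ 2 ∉ L := by
    intro h
    apply hv₀L
    have : v₀ ^ 2 = v ^ 2 + (2 * a) • (l * v₀) - (a * a) • l ^ 2 := by
      simp only [hvdef, Algebra.smul_def, map_mul, map_ofNat]; ring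
    rw [this]
    exact L.sub_mem (L.add_mem h (L.smul_mem _ (hcase _ hv₀)))
      (L.smul_mem _ (Submodule.mem_sup_right (Submodule.mem_span_singleton_self _)))
  obtain ⟨ε, hε, hεs⟩ := exists_ne_zero_add_smul_pow_ne_zero (k := k) v hls
  refine ⟨l + ε • v, m.add_mem hl ((m.restrictScalars k).smul_mem ε hv), v, hv, hεs,
    fun w hw => ?_⟩
  obtain ⟨u, hu, c, d, rfl⟩ := hL _ (Ideal.pow_mem_pow hv 2) hv2 w hw
  have hu₀' : u₀ ∈ m ^ 3 := hu₀
  have : u + c • l ^ 2 + d • v ^ 2 =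
      (algebraMap k A c * (l + ε • v) ^ 2 + algebraMap k A ((d - c * ε ^ 2) / ε) *
        ((l + ε • v) * v)) + (u - algebraMap k A (2 * c * ε + (d - c * ε ^ 2) / ε) * u₀) := by
    have hε' : algebraMap k A ε * algebraMap k A ε⁻¹ = 1 := by
      rw [← map_mul, mul_inv_cancel₀ hε, map_one]
    simp only [div_eq_mul_inv, Algebra.smul_def, map_add, map_sub, map_mul, map_pow, map_ofNat,
      ← hlv]
    linear_combination (algebraMap k A c * (algebraMap k A ε) ^ 2 - algebraMap k A d) * v ^ 2 * hε'
  rw [this]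
  exact Submodule.add_mem_sup (Ideal.mem_span_pair.2 ⟨_, _, rfl⟩)
    ((m ^ 3).sub_mem hu ((m ^ 3).mul_mem_left _ hu₀'))

/-- The hypotheses on the Hilbert function give `x` with `m ^ (t + 1) = (x ^ (t + 1))`, so a multiple
of `x` can be subtracted from the second generator to achieve `x ^ t y = 0`. -/
theorem exists_isFrame [CharZero k] [Module.Finite k A] [IsNoetherianRing A]
    (hres : ∀ a : A, ∃ c : k, a - algebraMap k A c ∈ maximalIdeal A) {s t : ℕ} (ht : 2 ≤ t)
    (hts : t + 1 ≤ s) (h2 : ∀ j, 2 ≤ j → j ≤ t → hilbertFn A j = 2)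
    (h1 : ∀ j, t + 1 ≤ j → j ≤ s → hilbertFn A j = 1) (h0 : ∀ j, s < j → hilbertFn A j = 0) :
    ∃ x y : A, IsFrame s t x y := by
  set m := maximalIdeal A with hm
  have hfr : ∀ j, Module.finrank k ((m ^ j).restrictScalars k) =
      hilbertFn A j + Module.finrank k ((m ^ (j + 1)).restrictScalars k) :=
    finrank_pow_eq_hilbertFn_add hres
  have hjac : m ≤ Ideal.jacobson ⊥ := (IsLocalRing.jacobson_eq_maximalIdeal _ bot_ne_top).ge
  have hbot : m ^ (s + 1) = ⊥ := by
    have h := hfr (s + 1)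
    rw [h0 _ (by omega), zero_add] at h
    have h3 : (m ^ (s + 1 + 1)).restrictScalars k = (m ^ (s + 1)).restrictScalars k :=
      Submodule.eq_of_le_of_finrank_le (Ideal.pow_le_pow_right (Nat.le_succ _)) h.le
    refine Submodule.eq_bot_of_le_smul_of_le_jacobson_bot m _ (IsNoetherian.noetherian _) ?_ hjac
    rw [smul_eq_mul, ← pow_succ']
    exact h3.ge
  have hsne : m ^ s ≠ ⊥ := by
    intro h
    have h3 := hfr s
    rw [h1 s hts le_rfl, h, Submodule.restrictScalars_bot, finrank_bot] at h3
    omega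
  obtain ⟨l, hl, hls⟩ := exists_pow_ne_zero_of_ideal_pow_ne_bot k m hsne
  have hfr2 : Module.finrank k ((m ^ 2).restrictScalars k) =
      Module.finrank k ((m ^ 3).restrictScalars k) + 2 := by
    rw [hfr 2, h2 2 le_rfl ht, add_comm]
  obtain ⟨x, hx, y₀, hy₀, hxs, hle⟩ := exists_sq_le_sup two_ne_zero hfr2 (by omega) hbot hl hls
  have hsq₀ : m ^ 2 = Ideal.span {x ^ 2, x * y₀} := by
    apply le_antisymm
    · refine Submodule.le_of_le_smul_of_le_jacobson_bot (IsNoetherian.noetherian _) hjac ?_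
      rwa [smul_eq_mul, ← pow_succ']
    · rw [Ideal.span_le]
      rintro _ (rfl | rfl)
      · exact Ideal.pow_mem_pow hx _
      · rw [pow_two]; exact Ideal.mul_mem_mul hx hy₀
  have htop : m ^ (t + 1) ≤ Ideal.span {x ^ (t + 1)} := by
    refine Submodule.le_of_le_smul_of_le_jacobson_bot (IsNoetherian.noetherian _) hjac ?_
    rw [smul_eq_mul, ← pow_succ']
    intro w hw
    have h3 := hfr (t + 1)
    rw [h1 _ le_rfl hts, add_comm 1] at h3
    have := Submodule.le_sup_span_singleton (W := (m ^ (t + 1 + 1)).restrictScalars k)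
      (Ideal.pow_le_pow_right (Nat.le_succ _)) h3.le
      (show x ^ (t + 1) ∈ (m ^ (t + 1)).restrictScalars k from Ideal.pow_mem_pow hx _)
      (pow_notMem_of_pow_ne_zero hbot hx hxs hts)
      (show w ∈ (m ^ (t + 1)).restrictScalars k from hw)
    obtain ⟨u, hu, v, hv, rfl⟩ := Submodule.mem_sup.1 this
    obtain ⟨c, rfl⟩ := Submodule.mem_span_singleton.1 hv
    rw [add_comm u, Algebra.smul_def]
    exact Submodule.add_mem_sup (Ideal.mul_mem_left _ _ (Ideal.mem_span_singleton_self _)) hu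
  obtain ⟨c, hc⟩ := Ideal.mem_span_singleton'.1 (htop (show x ^ t * y₀ ∈ m ^ (t + 1) by
    rw [pow_succ]; exact Ideal.mul_mem_mul (Ideal.pow_mem_pow hx _) hy₀))
  have hy : y₀ - c * x ∈ m := m.sub_mem hy₀ (m.mul_mem_left _ hx)
  have hsq : m ^ 2 = Ideal.span {x ^ 2, x * (y₀ - c * x)} := by
    rw [hsq₀]
    apply le_antisymm <;> rw [Ideal.span_le]
    · rintro _ (rfl | rfl)
      · exact Ideal.subset_span (by simp)
      · exact Ideal.mem_span_pair.2 ⟨c, 1, by ring⟩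
    · rintro _ (rfl | rfl)
      · exact Ideal.subset_span (by simp)
      · exact Ideal.mem_span_pair.2 ⟨-c, 1, by ring⟩
  refine ⟨x, y₀ - c * x, hx, hy, hsq, hxs, hbot, by linear_combination -hc, fun hmem => ?_⟩
  obtain ⟨j, rfl⟩ : ∃ j, t = j + 2 := ⟨t - 2, by omega⟩
  have hle2 : (m ^ (j + 2)).restrictScalars k ≤
      (m ^ (j + 2 + 1)).restrictScalars k ⊔ Submodule.span k {x ^ (j + 2)} := by
    intro w hw
    change w ∈ m ^ (j + 2) at hw
    rw [maximalIdeal_pow_eq hx hy hsq, Ideal.mem_span_pair] at hw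
    obtain ⟨a, b, rfl⟩ := hw
    obtain ⟨e, he⟩ := hres a
    rw [show a * x ^ (j + 2) + b * (x ^ (j + 1) * (y₀ - c * x)) =
      ((a - algebraMap k A e) * x ^ (j + 2) + b * (x ^ (j + 1) * (y₀ - c * x))) + e • x ^ (j + 2)
      by rw [Algebra.smul_def]; ring]
    refine Submodule.add_mem_sup (add_mem ?_ (Ideal.mul_mem_left _ _ hmem))
      (Submodule.smul_mem _ _ (Submodule.mem_span_singleton_self _))
    rw [Submodule.restrictScalars_mem, pow_succ']
    exact Ideal.mul_mem_mul he (Ideal.pow_mem_pow hx _)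
  have h6 := Submodule.finrank_mono hle2
  have h7 := Submodule.finrank_add_le_finrank_add_finrank ((m ^ (j + 2 + 1)).restrictScalars k)
    (Submodule.span k {x ^ (j + 2)})
  have h8 : Module.finrank k (Submodule.span k {x ^ (j + 2)}) ≤ 1 := by
    simpa using finrank_span_le_card (R := k) {x ^ (j + 2)}
  have h9 := hfr (j + 2)
  rw [h2 _ ht le_rfl] at h9
  omega

end Frame

/-! ### Polynomials evaluated at a nilpotent element -/

section NilpotentEval

open Polynomial

variable {k : Type*} [Field k]

theorem Polynomial.exists_X_pow_dvd_mul_sub_one {f : k[X]} (hf : f.coeff 0 ≠ 0) (m : ℕ) :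
    ∃ g : k[X], X ^ m ∣ f * g - 1 := by
  have h1 : IsCoprime (X : k[X]) f := (irreducible_X.coprime_iff_not_dvd).2 fun h =>
    hf (X_dvd_iff.1 h)
  obtain ⟨a, b, hab⟩ := (h1.pow_left (m := m))
  exact ⟨b, -a, by linear_combination hab⟩

/-- A polynomial with nonzero constant term has `n`-th roots modulo every power of `X`. -/
theorem Polynomial.exists_X_pow_dvd_pow_sub [IsAlgClosed k] [CharZero k] {f : k[X]}
    (hf : f.coeff 0 ≠ 0) {n : ℕ} (hn : 0 < n) (m : ℕ) :
    ∃ q : k[X], q.coeff 0 ≠ 0 ∧ X ^ (m + 1) ∣ q ^ n - f := by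
  induction m with
  | zero =>
    obtain ⟨a, ha⟩ := IsAlgClosed.exists_pow_nat_eq (f.coeff 0) hn
    refine ⟨C a, ?_, ?_⟩
    · rw [coeff_C_zero]
      rintro rfl
      exact hf (by rw [← ha, zero_pow hn.ne'])
    · rw [zero_add, pow_one, X_dvd_iff, coeff_sub, ← C_pow, coeff_C_zero, ha, sub_self]
  | succ m ih =>
    obtain ⟨q, hq, e, he⟩ := ih
    -- Newton step: correct the coefficient of degree `m + 1`.
    let a : k := -(e.coeff 0) / (n * q.coeff 0 ^ (n - 1))
    have hden : (n : k) * q.coeff 0 ^ (n - 1) ≠ 0 :=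
      mul_ne_zero (by exact_mod_cast hn.ne') (pow_ne_zero _ hq)
    refine ⟨q + C a * X ^ (m + 1), by simpa using hq, ?_⟩
    obtain ⟨r, hr⟩ := Polynomial.powAddExpansion q (C a * X ^ (m + 1)) n
    have hX : X ∣ e + (n : k[X]) * q ^ (n - 1) * C a := by
      rw [X_dvd_iff]
      have : (e + (n : k[X]) * q ^ (n - 1) * C a).coeff 0 =
          e.coeff 0 + n * q.coeff 0 ^ (n - 1) * a := by
        simp [coeff_zero_eq_eval_zero]
      rw [this, mul_div_cancel₀ _ hden, add_neg_cancel]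
    obtain ⟨d, hd⟩ := hX
    refine ⟨d + r * C a ^ 2 * X ^ m, ?_⟩
    rw [hr]
    linear_combination he + X ^ (m + 1) * hd

variable {A : Type*} [CommRing A] [Algebra k A] {x : A} {N : ℕ}

theorem aeval_eq_of_X_pow_dvd_sub (hx : x ^ N = 0) {f g : k[X]} (h : X ^ N ∣ f - g) :
    aeval x f = aeval x g := by
  obtain ⟨e, he⟩ := h
  rw [← sub_eq_zero, ← map_sub, he, map_mul, map_pow, aeval_X, hx, zero_mul]

theorem isUnit_aeval_of_coeff_zero_ne_zero (hx : x ^ N = 0) {f : k[X]} (hf : f.coeff 0 ≠ 0) :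
    IsUnit (aeval x f) := by
  obtain ⟨g, hg⟩ := exists_X_pow_dvd_mul_sub_one hf N
  have := aeval_eq_of_X_pow_dvd_sub hx hg
  rw [map_mul, map_one] at this
  exact IsUnit.of_mul_eq_one _ this

theorem exists_aeval_mul_eq_one (hN : N ≠ 0) (hx : x ^ N = 0) {f : k[X]} (hf : f.coeff 0 ≠ 0) :
    ∃ g : k[X], g.coeff 0 ≠ 0 ∧ aeval x f * aeval x g = 1 := by
  obtain ⟨g, hg⟩ := exists_X_pow_dvd_mul_sub_one hf N
  refine ⟨g, fun h0 => ?_, by simpa using aeval_eq_of_X_pow_dvd_sub hx hg⟩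
  have := X_dvd_iff.1 ((dvd_pow_self X hN).trans hg)
  simp [h0] at this

theorem exists_aeval_pow_eq [IsAlgClosed k] [CharZero k] (hx : x ^ N = 0) {f : k[X]}
    (hf : f.coeff 0 ≠ 0) {n : ℕ} (hn : 0 < n) :
    ∃ q : k[X], q.coeff 0 ≠ 0 ∧ aeval x q ^ n = aeval x f := by
  obtain ⟨q, hq, h⟩ := exists_X_pow_dvd_pow_sub hf hn N
  exact ⟨q, hq, by simpa using aeval_eq_of_X_pow_dvd_sub hx ((pow_dvd_pow X N.le_succ).trans h)⟩

theorem Polynomial.exists_eq_X_pow_mul {f : k[X]} (hf : f ≠ 0) :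
    ∃ (j : ℕ) (g : k[X]), g.coeff 0 ≠ 0 ∧ f = X ^ j * g := by
  obtain ⟨g, hg, hn⟩ := exists_eq_pow_rootMultiplicity_mul_and_not_dvd f hf 0
  rw [C_0, sub_zero] at hg hn
  exact ⟨_, g, fun h => hn (X_dvd_iff.2 h), hg⟩

theorem X_pow_dvd_of_aeval_eq_zero {s : ℕ} (hx : x ^ (s + 1) = 0) (hs : x ^ s ≠ 0) {f : k[X]}
    (hf : aeval x f = 0) : X ^ (s + 1) ∣ f := by
  rcases eq_or_ne f 0 with rfl | hf0
  · exact dvd_zero _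
  obtain ⟨j, g, hg, rfl⟩ := exists_eq_X_pow_mul hf0
  rw [map_mul, map_pow, aeval_X, (isUnit_aeval_of_coeff_zero_ne_zero hx hg).mul_left_eq_zero] at hf
  refine (pow_dvd_pow X ?_).trans (dvd_mul_right _ g)
  by_contra! hj
  exact hs (by rw [show s = j + (s - j) by omega, pow_add, hf, zero_mul])

end NilpotentEval

/-! ### The socle and the quadratic relation of a frame -/

section Relation

open Polynomial

variable {k A : Type*} [Field k] [CommRing A] [Algebra k A] [IsLocalRing A]

namespace IsFrame

variable {s t : ℕ} {x y : A}

theorem pow_succ_eq_zero (h : IsFrame s t x y) : x ^ (s + 1) = 0 := by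
  have := Ideal.pow_mem_pow h.left_mem (s + 1)
  rwa [h.pow_eq_bot] at this

theorem pow_mul_eq_zero_of_le (h : IsFrame s t x y) {j : ℕ} (hj : t ≤ j) : x ^ j * y = 0 := by
  rw [show j = j - t + t by omega, pow_add, mul_assoc, h.pow_mul_eq_zero, mul_zero]

theorem exists_eq_mul_of_mem_sq (h : IsFrame s t x y) {w : A} (hw : w ∈ maximalIdeal A ^ 2) :
    ∃ a b : A, w = x * (a * x + b * y) := by
  rw [h.sq_eq, Ideal.mem_span_pair] at hw
  obtain ⟨a, b, rfl⟩ := hw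
  exact ⟨a, b, by ring⟩

theorem mul_mem_sq {a b : A} (ha : a ∈ maximalIdeal A) (hb : b ∈ maximalIdeal A) :
    a * b ∈ maximalIdeal A ^ 2 := by
  rw [pow_two]; exact Ideal.mul_mem_mul ha hb

theorem mul_unit (h : IsFrame s t x y) {a b : A} (ha : IsUnit a) (hb : IsUnit b) :
    IsFrame s t (a * x) (b * y) where
  left_mem := Ideal.mul_mem_left _ _ h.left_mem
  right_mem := Ideal.mul_mem_left _ _ h.right_mem
  sq_eq := by
    rw [h.sq_eq]
    obtain ⟨a, rfl⟩ := ha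
    obtain ⟨b, rfl⟩ := hb
    apply le_antisymm <;> rw [Ideal.span_le]
    · rintro _ (rfl | rfl)
      · refine Ideal.mem_span_pair.2 ⟨↑(a⁻¹) ^ 2, 0, ?_⟩
        linear_combination (x ^ 2 * ((a : A) * ↑a⁻¹ + 1)) * a.mul_inv
      · refine Ideal.mem_span_pair.2 ⟨0, ↑(a⁻¹) * ↑(b⁻¹), ?_⟩
        linear_combination (x * y * ((b : A) * ↑b⁻¹)) * a.mul_inv + x * y * b.mul_inv
    · rintro _ (rfl | rfl)
      · exact Ideal.mem_span_pair.2 ⟨a ^ 2, 0, by ring⟩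
      · exact Ideal.mem_span_pair.2 ⟨0, a * b, by ring⟩
  pow_ne_zero := by
    rw [mul_pow]
    exact fun h0 => h.pow_ne_zero ((ha.pow s).mul_right_eq_zero.1 h0)
  pow_eq_bot := h.pow_eq_bot
  pow_mul_eq_zero := by
    linear_combination a ^ t * b * h.pow_mul_eq_zero
  pow_mul_notMem := fun hmem => h.pow_mul_notMem <| by
    rw [← Ideal.unit_mul_mem_iff_mem _ ((ha.pow (t - 1)).mul hb)]
    convert hmem using 1
    ring

theorem exists_aeval_of_mem_sq (h : IsFrame s t x y)
    (hres : ∀ a : A, ∃ c : k, a - algebraMap k A c ∈ maximalIdeal A) {w : A}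
    (hw : w ∈ maximalIdeal A ^ 2) :
    ∃ f g : k[X], w = x ^ 2 * aeval x f + x * aeval x g * y := by
  have key : ∀ n j, j + 2 + n = s + 1 → ∀ w ∈ maximalIdeal A ^ (j + 2),
      ∃ f g : k[X], w = x ^ 2 * aeval x f + x * aeval x g * y := by
    intro n
    induction n with
    | zero =>
      intro j hj w hw
      rw [show j + 2 = s + 1 by omega, h.pow_eq_bot, Ideal.mem_bot] at hw
      exact ⟨0, 0, by simp [hw]⟩
    | succ n ih =>
      intro j hj w hw
      rw [maximalIdeal_pow_eq h.left_mem h.right_mem h.sq_eq, Ideal.mem_span_pair] at hw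
      obtain ⟨a, b, rfl⟩ := hw
      obtain ⟨c, hc⟩ := hres a
      obtain ⟨d, hd⟩ := hres b
      have hmem : (a - algebraMap k A c) * x ^ (j + 2) +
          (b - algebraMap k A d) * (x ^ (j + 1) * y) ∈ maximalIdeal A ^ (j + 1 + 2) := by
        rw [show j + 1 + 2 = (j + 2) + 1 by ring, pow_succ' _ (j + 2)]
        refine add_mem (Ideal.mul_mem_mul hc (Ideal.pow_mem_pow h.left_mem _))
          (Ideal.mul_mem_mul hd ?_)
        rw [show j + 2 = j + 1 + 1 by ring, pow_succ _ (j + 1)]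
        exact Ideal.mul_mem_mul (Ideal.pow_mem_pow h.left_mem _) h.right_mem
      obtain ⟨f, g, hfg⟩ := ih (j + 1) (by omega) _ hmem
      refine ⟨C c * X ^ j + f, C d * X ^ j + g, ?_⟩
      simp only [map_add, map_mul, aeval_C, map_pow, aeval_X]
      linear_combination hfg
  by_cases hs : 1 ≤ s
  · exact key (s - 1) 0 (by omega) w hw
  · have hw0 : w ∈ maximalIdeal A ^ (s + 1) := Ideal.pow_le_pow_right (by omega) hw
    rw [h.pow_eq_bot, Ideal.mem_bot] at hw0
    exact ⟨0, 0, by simp [hw0]⟩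

/-- The maximal ideal is `(x, y)` plus the annihilator of `x` in it, since `x m ⊆ m ^ 2 = x (x, y)`. -/
theorem exists_mul_left_eq_zero (h : IsFrame s t x y) {a : A} (ha : a ∈ maximalIdeal A) :
    ∃ b c z : A, z ∈ maximalIdeal A ∧ x * z = 0 ∧ a = b * x + c * y + z := by
  obtain ⟨b, c, hbc⟩ := h.exists_eq_mul_of_mem_sq (mul_mem_sq h.left_mem ha)
  refine ⟨b, c, a - (b * x + c * y), ?_, by linear_combination hbc, by ring⟩
  exact sub_mem ha (add_mem (Ideal.mul_mem_left _ _ h.left_mem) (Ideal.mul_mem_left _ _ h.right_mem))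

/-- To lie in the socle it suffices to be killed by `x`, by `y` and by the annihilator of `x` in the
maximal ideal. -/
theorem mem_socle (h : IsFrame s t x y) {a : A} (hx : x * a = 0) (hy : y * a = 0)
    (hz : ∀ z ∈ maximalIdeal A, x * z = 0 → z * a = 0) : ∀ b ∈ maximalIdeal A, b * a = 0 := by
  intro b hb
  obtain ⟨c, d, z, hzm, hxz, rfl⟩ := h.exists_mul_left_eq_zero hb
  linear_combination c * hx + d * hy + hz z hzm hxz

theorem mul_eq_zero_of_mem_sq (h : IsFrame s t x y) {w z : A} (hw : w ∈ maximalIdeal A ^ 2)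
    (hz : x * z = 0) : z * w = 0 := by
  obtain ⟨a, b, rfl⟩ := h.exists_eq_mul_of_mem_sq hw
  linear_combination (a * x + b * y) * hz

/-- The element `x ^ (t - 1) y ^ 2` lies in the socle. It is nonzero: otherwise `x ^ (t - 1) y` would
be in the socle `k x ^ s`, hence in `m ^ (t + 1)`. -/
theorem exists_pow_mul_sq (h : IsFrame s t x y) (ht : 2 ≤ t) (hts : t + 1 ≤ s)
    (hsoc : ∀ a : A, (∀ b ∈ maximalIdeal A, b * a = 0) → ∃ c : k, a = c • x ^ s) :
    ∃ c : k, c ≠ 0 ∧ x ^ (t - 1) * y ^ 2 = c • x ^ s := by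
  obtain ⟨a, b, hab⟩ := h.exists_eq_mul_of_mem_sq (mul_mem_sq h.right_mem h.right_mem)
  have hx0 : x * (x ^ (t - 1) * y) = 0 := by
    rw [← mul_assoc, ← pow_succ', show t - 1 + 1 = t by omega, h.pow_mul_eq_zero]
  have hzero : ∀ z, x * z = 0 → z * (x ^ (t - 1) * y) = 0 := fun z hz => by
    rw [show t - 1 = t - 2 + 1 by omega, pow_succ]
    linear_combination x ^ (t - 2) * y * hz
  obtain ⟨c, hc⟩ := hsoc (x ^ (t - 1) * y ^ 2) (h.mem_socle
    (by linear_combination y * hx0)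
    (by linear_combination x ^ (t - 1) * y * hab + (a * x + b * y) * hx0)
    (fun z _ hz => by linear_combination y * hzero z hz))
  refine ⟨c, ?_, hc⟩
  rintro rfl
  rw [zero_smul] at hc
  obtain ⟨d, hd⟩ := hsoc (x ^ (t - 1) * y) (h.mem_socle hx0 (by linear_combination hc)
    (fun z _ hz => hzero z hz))
  refine h.pow_mul_notMem ?_
  rw [hd]
  exact ((maximalIdeal A ^ (t + 1)).restrictScalars k).smul_mem d
    (Ideal.pow_le_pow_right hts (Ideal.pow_mem_pow h.left_mem s))

/-- The summand annihilated by `x` can be chosen to be annihilated by `y` as well: its product with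
`y` is in the socle, and is cancelled by a multiple of `x ^ (t - 1) y`. -/
theorem exists_mul_eq_zero (h : IsFrame s t x y) (ht : 2 ≤ t) (hts : t + 1 ≤ s)
    (hsoc : ∀ a : A, (∀ b ∈ maximalIdeal A, b * a = 0) → ∃ c : k, a = c • x ^ s) {a : A}
    (ha : a ∈ maximalIdeal A) :
    ∃ b c z : A, z ∈ maximalIdeal A ∧ x * z = 0 ∧ y * z = 0 ∧ a = b * x + c * y + z := by
  obtain ⟨b, c, z, hz, hxz, rfl⟩ := h.exists_mul_left_eq_zero ha
  have hyz := mul_mem_sq h.right_mem hz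
  obtain ⟨e, he⟩ := hsoc (y * z) (h.mem_socle (by linear_combination y * hxz)
    (by linear_combination h.mul_eq_zero_of_mem_sq (mul_mem_sq h.right_mem h.right_mem) hxz)
    (fun z' _ hz' => h.mul_eq_zero_of_mem_sq hyz hz'))
  obtain ⟨d, hd0, hd⟩ := h.exists_pow_mul_sq ht hts hsoc
  have hx0 : x * (x ^ (t - 1) * y) = 0 := by
    rw [← mul_assoc, ← pow_succ', show t - 1 + 1 = t by omega, h.pow_mul_eq_zero]
  have hyz' : y * z = algebraMap k A (e / d) * (x ^ (t - 1) * y ^ 2) := by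
    rw [hd, he, ← Algebra.smul_def, smul_smul, div_mul_cancel₀ _ hd0]
  refine ⟨b, c + algebraMap k A (e / d) * x ^ (t - 1),
    z - algebraMap k A (e / d) * (x ^ (t - 1) * y), ?_, ?_, ?_, by ring⟩
  · exact sub_mem hz (Ideal.mul_mem_left _ _ (Ideal.mul_mem_left _ _ h.right_mem))
  · linear_combination hxz - algebraMap k A (e / d) * hx0
  · linear_combination hyz'

/-- The quadratic relation of a frame, before normalization. The power `x ^ (s - t + 1)` and the unit
`w` come from comparing with `x ^ (t - 1) y ^ 2 = c x ^ s`. -/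
theorem exists_sq_eq (h : IsFrame s t x y) (ht : 2 ≤ t) (hts : t + 1 ≤ s)
    (hres : ∀ a : A, ∃ c : k, a - algebraMap k A c ∈ maximalIdeal A)
    (hsoc : ∀ a : A, (∀ b ∈ maximalIdeal A, b * a = 0) → ∃ c : k, a = c • x ^ s) :
    ∃ w g : k[X], w.coeff 0 ≠ 0 ∧
      y ^ 2 = x * aeval x g * y + aeval x w * x ^ (s - t + 1) := by
  obtain ⟨f, g, hfg⟩ := h.exists_aeval_of_mem_sq hres
    (show y ^ 2 ∈ maximalIdeal A ^ 2 from Ideal.pow_mem_pow h.right_mem 2)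
  obtain ⟨c, hc0, hc⟩ := h.exists_pow_mul_sq ht hts hsoc
  obtain ⟨i, rfl⟩ : ∃ i, t = i + 1 := ⟨t - 1, by omega⟩
  obtain ⟨j, rfl⟩ : ∃ j, s = i + 1 + j + 1 := ⟨s - i - 2, by omega⟩
  have h1 : aeval x (X ^ (i + 2) * f - C c * X ^ (i + 1 + j + 1)) = 0 := by
    simp only [map_sub, map_mul, map_pow, aeval_X, aeval_C]
    rw [Algebra.smul_def, hfg] at hc
    simp only [Nat.add_sub_cancel] at hc
    linear_combination hc - aeval x g * h.pow_mul_eq_zero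
  obtain ⟨e, he⟩ := X_pow_dvd_of_aeval_eq_zero h.pow_succ_eq_zero h.pow_ne_zero h1
  have hf : f = X ^ j * (C c + X * e) := by
    refine mul_left_cancel₀ (_root_.pow_ne_zero (i + 2) (X_ne_zero (R := k))) ?_
    linear_combination he
  refine ⟨C c + X * e, g, by simpa using hc0, ?_⟩
  rw [hfg, hf, show i + 1 + j + 1 - (i + 1) + 1 = j + 2 by omega]
  simp only [map_add, map_mul, map_pow, aeval_X, aeval_C]
  ring

end IsFrame

end Relation

/-! ### Rescaling a frame to normalize the quadratic relation -/

section NormalForm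

open Polynomial

variable {k A : Type*} [Field k] [IsAlgClosed k] [CharZero k] [CommRing A] [Algebra k A]
  [IsLocalRing A] {s t : ℕ} {x y : A}

/-- A frame whose second element satisfies
`y ^ 2 = x ^ (p + 1) y + q(x) x ^ (s - t + 1)`. The coefficient `z` of the model ideal is encoded as
a polynomial `q` in the first variable, so that it can be evaluated in any `k`-algebra. -/
structure IsNormalFrame (k : Type*) {A : Type*} [Field k] [CommRing A] [Algebra k A]
    [IsLocalRing A] (s t p : ℕ) (q : k[X]) (x y : A) : Prop extends IsFrame s t x y where
  sq_right : y ^ 2 = x ^ (p + 1) * y + aeval x q * x ^ (s - t + 1)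

namespace IsFrame

/-- Without a mixed term, an `(s - t + 1)`-th root of the unit `w` is absorbed into `x`. The mixed term
`x ^ t y = 0` of the model with `p = t - 1` is harmless. -/
theorem exists_isNormalFrame_of_mul_eq_zero (h : IsFrame s t x y) (ht : 0 < t) {w : k[X]}
    (hw : w.coeff 0 ≠ 0) (hy : y ^ 2 = aeval x w * x ^ (s - t + 1)) :
    ∃ x' y' : A, IsNormalFrame k s t (t - 1) 1 x' y' := by
  obtain ⟨v, hv, hvw⟩ := exists_aeval_pow_eq h.pow_succ_eq_zero hw (show 0 < s - t + 1 by omega)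
  have hfr := h.mul_unit (isUnit_aeval_of_coeff_zero_ne_zero h.pow_succ_eq_zero hv)
    (isUnit_one (M := A))
  refine ⟨_, _, hfr, ?_⟩
  rw [show t - 1 + 1 = t by omega, hfr.pow_mul_eq_zero, map_one]
  linear_combination hy - x ^ (s - t + 1) * hvw

/-- For `a`, `b` units in `k[x]`, replacing `x`, `y` by `a x`, `b y` multiplies `u` by
`b / a ^ (p + 1)` and `w` by `b ^ 2 / a ^ (s - t + 1)`. Unless `2 (p + 1) = s - t + 1`, both can be
made `1` at once. -/
theorem exists_isNormalFrame_of_ne (h : IsFrame s t x y) {p : ℕ} (hp : 2 * (p + 1) ≠ s - t + 1)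
    {u w : k[X]} (hu : u.coeff 0 ≠ 0) (hw : w.coeff 0 ≠ 0)
    (hy : y ^ 2 = x ^ (p + 1) * aeval x u * y + aeval x w * x ^ (s - t + 1)) :
    ∃ x' y' : A, IsNormalFrame k s t p 1 x' y' := by
  have hx := h.pow_succ_eq_zero
  obtain ⟨n, hn⟩ : ∃ n, n = s - t + 1 := ⟨_, rfl⟩
  rw [← hn] at hp hy
  obtain ⟨u', hu', huu'⟩ := exists_aeval_mul_eq_one (Nat.succ_ne_zero s) hx hu
  obtain ⟨w', hw', hww'⟩ := exists_aeval_mul_eq_one (Nat.succ_ne_zero s) hx hw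
  have hunit : ∀ {f : k[X]}, f.coeff 0 ≠ 0 → IsUnit (aeval x f) :=
    isUnit_aeval_of_coeff_zero_ne_zero hx
  obtain ⟨a, ha, haw⟩ : ∃ a : k[X], a.coeff 0 ≠ 0 ∧
      aeval x a ^ n * aeval x u ^ 2 = aeval x a ^ (2 * (p + 1)) * aeval x w := by
    rcases lt_or_gt_of_ne hp with hlt | hlt
    · obtain ⟨a, ha, haw⟩ := exists_aeval_pow_eq hx (f := w * u' * u')
        (by simp only [mul_coeff_zero]; exact mul_ne_zero (mul_ne_zero hw hu') hu')
        (Nat.sub_pos_of_lt hlt)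
      refine ⟨a, ha, ?_⟩
      rw [show n = 2 * (p + 1) + (n - 2 * (p + 1)) by omega, pow_add, haw]
      simp only [map_mul]
      linear_combination aeval x a ^ (2 * (p + 1)) * aeval x w *
        (aeval x u * aeval x u' + 1) * huu'
    · obtain ⟨a, ha, haw⟩ := exists_aeval_pow_eq hx (f := u * u * w')
        (by simp only [mul_coeff_zero]; exact mul_ne_zero (mul_ne_zero hu hu) hw')
        (Nat.sub_pos_of_lt hlt)
      refine ⟨a, ha, ?_⟩
      rw [show 2 * (p + 1) = n + (2 * (p + 1) - n) by omega, pow_add, haw]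
      simp only [map_mul]
      linear_combination -(aeval x a ^ n * aeval x u ^ 2) * hww'
  refine ⟨_, _, h.mul_unit (hunit ha) (((hunit ha).pow (p + 1)).mul (hunit hu')), ?_⟩
  rw [map_one, ← hn]
  linear_combination (aeval x a ^ (p + 1) * aeval x u') ^ 2 * hy +
    (aeval x a ^ (p + 1)) ^ 2 * x ^ (p + 1) * y * aeval x u' * huu' -
    x ^ n * aeval x u' ^ 2 * haw + x ^ n * aeval x a ^ n *
      (aeval x u * aeval x u' + 1) * huu'

/-- In the critical case `2 (p + 1) = s - t + 1` the unit `w / u ^ 2` is invariant under rescaling,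
except that it is re-expressed in the new `x`: thus `c + x ^ d v` with `v` a unit becomes
`c + x ^ d`. As `x ^ t y = 0`, the unit `u` matters only modulo `x ^ (t - p - 1)`, so an `x ^ d` with
`d ≥ t - p - 1` can be removed. -/
theorem exists_isNormalFrame_of_eq (h : IsFrame s t x y) {p : ℕ} (hp : 2 * (p + 1) = s - t + 1)
    {u w : k[X]} (hu : u.coeff 0 ≠ 0) (hw : w.coeff 0 ≠ 0)
    (hy : y ^ 2 = x ^ (p + 1) * aeval x u * y + aeval x w * x ^ (s - t + 1)) :
    ∃ (x' y' : A) (c : k), c ≠ 0 ∧ (IsNormalFrame k s t p (C c) x' y' ∨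
      ∃ d, 1 ≤ d ∧ d + p + 2 ≤ t ∧ IsNormalFrame k s t p (C c + X ^ d) x' y') := by
  have hx := h.pow_succ_eq_zero
  obtain ⟨n, hn⟩ : ∃ n, n = s - t + 1 := ⟨_, rfl⟩
  rw [← hn] at hp hy
  obtain ⟨u', hu', huu'⟩ := exists_aeval_mul_eq_one (Nat.succ_ne_zero s) hx hu
  have hunit : ∀ {f : k[X]}, f.coeff 0 ≠ 0 → IsUnit (aeval x f) :=
    isUnit_aeval_of_coeff_zero_ne_zero hx
  set f : k[X] := w * u' * u' with hf
  have hfx : aeval x f = aeval x w * aeval x u' * aeval x u' := by simp only [hf, map_mul]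
  set c := f.coeff 0 with hc
  have hc0 : c ≠ 0 := by
    simp only [hc, hf, mul_coeff_zero]; exact mul_ne_zero (mul_ne_zero hw hu') hu'
  have hsmall : (∃ d v, 1 ≤ d ∧ d + p + 2 ≤ t ∧ v.coeff 0 ≠ 0 ∧ f = C c + X ^ d * v) ∨
      ∃ v, f = C c + X ^ (t - p - 1) * v ∧ (X ∣ X ^ (t - p - 1) * v) := by
    by_cases h0 : f - C c = 0
    · exact Or.inr ⟨0, by linear_combination h0, by simp⟩
    obtain ⟨d, v, hv, hdv⟩ := exists_eq_X_pow_mul h0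
    have hdvd : X ∣ f - C c := by simp [X_dvd_iff, hc]
    have hd : 1 ≤ d := by
      by_contra! hd
      obtain rfl : d = 0 := by omega
      rw [hdv, pow_zero, one_mul, X_dvd_iff] at hdvd
      exact hv hdvd
    by_cases hdt : d + p + 2 ≤ t
    · exact Or.inl ⟨d, v, hd, hdt, hv, by linear_combination hdv⟩
    · have : X ^ (t - p - 1) * (X ^ (d - (t - p - 1)) * v) = f - C c := by
        rw [hdv, ← mul_assoc, ← pow_add, show t - p - 1 + (d - (t - p - 1)) = d by omega]
      exact Or.inr ⟨_, by linear_combination -this, this ▸ hdvd⟩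
  rcases hsmall with ⟨d, v, hd, hdt, hv, hfv⟩ | ⟨v, hfv, hXv⟩
  · obtain ⟨a, ha, hav⟩ := exists_aeval_pow_eq hx hv hd
    refine ⟨_, _, c, hc0, Or.inr ⟨d, hd, hdt,
      h.mul_unit (hunit ha) (((hunit ha).pow (p + 1)).mul (hunit hu')), ?_⟩⟩
    have hfx' := congrArg (aeval x) hfv
    simp only [map_add, map_mul, map_pow, aeval_X, aeval_C] at hfx' ⊢
    rw [hfx, ← hav] at hfx'
    rw [← hp] at hy
    rw [← hn, ← hp]
    linear_combination (aeval x a ^ (p + 1) * aeval x u') ^ 2 * hy +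
      (aeval x a ^ (p + 1)) ^ 2 * x ^ (p + 1) * y * aeval x u' * huu' +
      (aeval x a * x) ^ (2 * (p + 1)) * hfx'
  · obtain ⟨ρ, hρ, e, he⟩ := exists_X_pow_dvd_pow_sub (f := 1 + C c⁻¹ * (X ^ (t - p - 1) * v))
      (by
        rw [X_dvd_iff] at hXv
        rw [coeff_add, coeff_C_mul, hXv]; simp) (n := 2) two_pos (s + 1)
    -- Of the two square roots, take the one with constant term `1`.
    obtain ⟨ρ, hρ1, e, he⟩ : ∃ ρ : k[X], ρ.coeff 0 = 1 ∧
        X ^ (s + 1 + 1) ∣ ρ ^ 2 - (1 + C c⁻¹ * (X ^ (t - p - 1) * v)) := by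
      have h1 : ρ.coeff 0 ^ 2 = 1 := by
        rw [X_dvd_iff, coeff_zero_eq_eval_zero] at hXv
        have := congrArg (eval 0) he
        rw [eval_sub, eval_add, eval_mul (p := C _), hXv] at this
        simpa [sub_eq_zero, coeff_zero_eq_eval_zero] using this
      rcases mul_eq_zero.1 (show (ρ.coeff 0 - 1) * (ρ.coeff 0 + 1) = 0 by
        linear_combination h1) with h1 | h1
      · exact ⟨ρ, sub_eq_zero.1 h1, e, he⟩
      · exact ⟨-ρ, by rw [coeff_neg, eq_neg_of_add_eq_zero_left h1, neg_neg], e,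
          by rw [neg_sq, he]⟩
    have hρ0 : ρ.coeff 0 ≠ 0 := by simp [hρ1]
    obtain ⟨ρ', hρ', hρρ'⟩ := exists_aeval_mul_eq_one (Nat.succ_ne_zero s) hx hρ0
    have hsq : aeval x ρ ^ 2 = 1 + algebraMap k A c⁻¹ * (x ^ (t - p - 1) * aeval x v) := by
      have := aeval_eq_of_X_pow_dvd_sub (x := x) (N := s + 1 + 1)
        (by rw [pow_succ, hx, zero_mul]) ⟨e, he⟩
      simpa only [map_pow, map_add, map_one, map_mul, aeval_C, aeval_X] using this
    have hcc : algebraMap k A c * algebraMap k A c⁻¹ = 1 := by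
      rw [← map_mul, mul_inv_cancel₀ hc0, map_one]
    have hfx' := congrArg (aeval x) hfv
    simp only [map_add, map_mul, map_pow, aeval_X, aeval_C] at hfx'
    rw [hfx] at hfx'
    have hxy : x ^ (t - p - 1) * x ^ (p + 1) * y = 0 := by
      rw [← pow_add, h.pow_mul_eq_zero_of_le (by omega)]
    have hρxy : aeval x ρ * (x ^ (p + 1) * y) = x ^ (p + 1) * y := by
      have hu2 : IsUnit (aeval x (ρ + 1)) := hunit (by
        rw [coeff_add, hρ1, coeff_one_zero]; norm_num)
      rw [map_add, map_one] at hu2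
      refine sub_eq_zero.1 (hu2.mul_right_eq_zero.1 ?_)
      linear_combination x ^ (p + 1) * y * hsq + algebraMap k A c⁻¹ * aeval x v * hxy
    have hfr := h.mul_unit (isUnit_one (M := A)) ((hunit hu').mul (hunit hρ'))
    rw [one_mul] at hfr
    refine ⟨_, _, c, hc0, Or.inl ⟨hfr, ?_⟩⟩
    rw [aeval_C, ← hn]
    linear_combination (aeval x u' * aeval x ρ') ^ 2 * hy +
      aeval x ρ' ^ 2 * x ^ n * hfx' + aeval x ρ' ^ 2 * x ^ (p + 1) * y * aeval x u' * huu' -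
      aeval x ρ' ^ 2 * x ^ n * (algebraMap k A c * hsq + x ^ (t - p - 1) * aeval x v * hcc)
      - aeval x u' * aeval x ρ' ^ 2 * hρxy + aeval x u' * aeval x ρ' * x ^ (p + 1) * y * hρρ' +
      algebraMap k A c * x ^ n * (aeval x ρ * aeval x ρ' + 1) * hρρ'

theorem exists_isNormalFrame (h : IsFrame s t x y) (ht : 2 ≤ t) (hts : t + 1 ≤ s)
    (hres : ∀ a : A, ∃ c : k, a - algebraMap k A c ∈ maximalIdeal A)
    (hsoc : ∀ a : A, (∀ b ∈ maximalIdeal A, b * a = 0) → ∃ c : k, a = c • x ^ s) :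
    ∃ (p : ℕ) (x' y' : A), p < t ∧ ((¬ IsCritical s t p ∧ IsNormalFrame k s t p 1 x' y') ∨
      (IsCritical s t p ∧ ∃ c : k, c ≠ 0 ∧ (IsNormalFrame k s t p (C c) x' y' ∨
        ∃ d, 1 ≤ d ∧ d + p + 2 ≤ t ∧ IsNormalFrame k s t p (C c + X ^ d) x' y'))) := by
  obtain ⟨w, g, hw, hy⟩ := h.exists_sq_eq ht hts hres hsoc
  by_cases hg : ∃ p u, p + 2 ≤ t ∧ u.coeff 0 ≠ 0 ∧ g = X ^ p * u
  · obtain ⟨p, u, hp, hu, rfl⟩ := hg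
    rw [map_mul, map_pow, aeval_X, ← mul_assoc, ← pow_succ'] at hy
    by_cases hcrit : 2 * (p + 1) = s - t + 1
    · obtain ⟨x', y', c, hc, hfr⟩ := h.exists_isNormalFrame_of_eq hcrit hu hw hy
      exact ⟨p, x', y', by omega, Or.inr ⟨⟨hp, by omega⟩, c, hc, hfr⟩⟩
    · obtain ⟨x', y', hfr⟩ := h.exists_isNormalFrame_of_ne hcrit hu hw hy
      exact ⟨p, x', y', by omega, Or.inl ⟨fun hc => hcrit (by have := hc.2; omega), hfr⟩⟩
  · have hgy : x * aeval x g * y = 0 := by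
      rcases eq_or_ne g 0 with rfl | hg0
      · simp
      obtain ⟨j, u, hu, rfl⟩ := exists_eq_X_pow_mul hg0
      have hj : t ≤ j + 1 := by
        by_contra! hj
        exact hg ⟨j, u, by omega, hu, rfl⟩
      rw [map_mul, map_pow, aeval_X]
      linear_combination aeval x u * h.pow_mul_eq_zero_of_le hj
    rw [hgy, zero_add] at hy
    obtain ⟨x', y', hfr⟩ := h.exists_isNormalFrame_of_mul_eq_zero (by omega) hw hy
    exact ⟨t - 1, x', y', by omega, Or.inl ⟨fun hc => by have := hc.1; omega, hfr⟩⟩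

end IsFrame

end NormalForm

/-! ### The remaining variables: an orthonormal complement -/

section Complement

variable {k A : Type*} [Field k] [IsAlgClosed k] [CharZero k] [CommRing A] [Algebra k A]
  [IsLocalRing A] {s t : ℕ} {x y : A}

/-- A family in the maximal ideal that is annihilated by `x` and `y` and is orthonormal for the
product with values in the socle `k x ^ s`. -/
structure IsOrthonormalComplement {A ι : Type*} [CommRing A] [IsLocalRing A] (s : ℕ) (x y : A)
    (e : ι → A) : Prop where
  mem : ∀ i, e i ∈ maximalIdeal A
  left_mul : ∀ i, x * e i = 0
  right_mul : ∀ i, y * e i = 0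
  mul_self : ∀ i, e i ^ 2 = x ^ s
  mul_of_ne : ∀ i j, i ≠ j → e i * e j = 0

/-- The elements of the maximal ideal annihilated by `x` and `y`, as a `k`-subspace. -/
def annihilatorOfPair (k : Type*) {A : Type*} [Field k] [CommRing A] [Algebra k A]
    [IsLocalRing A] (x y : A) : Submodule k A :=
  (maximalIdeal A).restrictScalars k ⊓ LinearMap.ker (LinearMap.mulLeft k x) ⊓
    LinearMap.ker (LinearMap.mulLeft k y)

omit [IsAlgClosed k] [CharZero k] in
theorem mem_annihilatorOfPair {z : A} : z ∈ annihilatorOfPair k x y ↔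
    z ∈ maximalIdeal A ∧ x * z = 0 ∧ y * z = 0 := by
  simp [annihilatorOfPair, and_assoc]

namespace IsFrame

omit [IsAlgClosed k] [CharZero k] in
theorem mul_annihilatorOfPair_mem_socle (h : IsFrame s t x y) {z z' : A}
    (hz : z ∈ annihilatorOfPair k x y) (hz' : z' ∈ annihilatorOfPair k x y) :
    ∀ b ∈ maximalIdeal A, b * (z * z') = 0 := by
  rw [mem_annihilatorOfPair] at hz hz'
  exact h.mem_socle (by linear_combination z' * hz.2.1) (by linear_combination z' * hz.2.2)
    (fun w _ hw => h.mul_eq_zero_of_mem_sq (mul_mem_sq hz.1 hz'.1) hw)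

/-- Products in the annihilator of `x` and `y` lie in the socle `k x ^ s`, which gives a symmetric
bilinear form. Normalize the non-isotropic members of an orthogonal basis; the isotropic ones are
multiples of `x ^ s`. -/
theorem exists_isOrthonormalComplement [Module.Finite k A] (h : IsFrame s t x y) (ht : 2 ≤ t)
    (hts : t + 1 ≤ s)
    (hsoc : ∀ a : A, (∀ b ∈ maximalIdeal A, b * a = 0) → ∃ c : k, a = c • x ^ s) :
    ∃ (ι : Type) (_ : Fintype ι) (e : ι → A), IsOrthonormalComplement s x y e ∧
      annihilatorOfPair k x y ≤ Submodule.span k (insert (x ^ s) (Set.range e)) := by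
  obtain ⟨φ, hφ⟩ := Module.Projective.exists_dual_eq_one k h.pow_ne_zero
  set Z := annihilatorOfPair k x y with hZ
  let B : LinearMap.BilinForm k Z := ((LinearMap.mul k A).compr₂ φ).compl₁₂ Z.subtype Z.subtype
  have hB : ∀ z z' : Z, (z : A) * z' = B z z' • x ^ s := by
    intro z z'
    obtain ⟨c, hc⟩ := hsoc _ (h.mul_annihilatorOfPair_mem_socle z.2 z'.2)
    have : B z z' = c := by
      change φ ((z : A) * z') = c
      rw [hc, map_smul, hφ, smul_eq_mul, mul_one]
    rw [this, hc]
  have hBsymm : LinearMap.IsSymm B := ⟨fun z z' => congrArg φ (mul_comm (z : A) z')⟩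
  have : Invertible (2 : k) := invertibleOfNonzero two_ne_zero
  obtain ⟨v, hv⟩ := LinearMap.BilinForm.exists_orthogonal_basis hBsymm
  rw [LinearMap.isOrthoᵢ_def] at hv
  choose r hr using fun i => IsAlgClosed.exists_pow_nat_eq (B (v i) (v i)) two_pos
  have hr0 : ∀ i : {i // B (v i) (v i) ≠ 0}, r i ≠ 0 := fun i h0 => i.2 (by
    rw [← hr, h0]; simp)
  have hvZ : ∀ i, (v i : A) ∈ maximalIdeal A ∧ x * (v i : A) = 0 ∧ y * (v i : A) = 0 :=
    fun i => mem_annihilatorOfPair.1 (v i).2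
  classical
  refine ⟨{i // B (v i) (v i) ≠ 0}, inferInstance, fun i => (r i)⁻¹ • (v i : A),
    ⟨fun i => ?_, fun i => ?_, fun i => ?_, fun i => ?_, fun i j hij => ?_⟩, ?_⟩
  · exact ((maximalIdeal A).restrictScalars k).smul_mem _ (hvZ i).1
  · rw [mul_smul_comm, (hvZ i).2.1, smul_zero]
  · rw [mul_smul_comm, (hvZ i).2.2, smul_zero]
  · rw [smul_pow, pow_two (v i : A), hB, ← hr, smul_smul, ← mul_pow, inv_mul_cancel₀ (hr0 i),
      one_pow, one_smul]
  · rw [smul_mul_smul_comm, hB, hv _ _ (fun h => hij (Subtype.ext h)), zero_smul, smul_zero]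
  · have hmem : ∀ i, (v i : A) ∈ Submodule.span k (insert (x ^ s)
        (Set.range fun i : {i // B (v i) (v i) ≠ 0} => (r i)⁻¹ • (v i : A))) := by
      intro i
      by_cases hi : B (v i) (v i) = 0
      · -- An isotropic member of the orthogonal basis is in the radical, hence in the socle.
        have hrad : ∀ z : Z, (v i : A) * z = 0 := by
          intro z
          have : B (v i) = 0 := v.ext fun j => by
            rcases eq_or_ne i j with rfl | hij
            · exact hi
            · exact hv _ _ hij
          rw [hB, this, LinearMap.zero_apply, zero_smul]
        obtain ⟨c, hc⟩ := hsoc (v i) (fun b hb => by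
          obtain ⟨b, c, z, hz, hxz, hyz, rfl⟩ := h.exists_mul_eq_zero ht hts hsoc hb
          linear_combination b * (hvZ i).2.1 + c * (hvZ i).2.2 +
            hrad ⟨z, mem_annihilatorOfPair.2 ⟨hz, hxz, hyz⟩⟩)
        rw [hc]
        exact Submodule.smul_mem _ _ (Submodule.subset_span (Set.mem_insert _ _))
      · have h1 : (v i : A) = r i • ((r i)⁻¹ • (v i : A)) := by
          rw [smul_smul, mul_inv_cancel₀ (hr0 ⟨i, hi⟩), one_smul]
        rw [h1]
        exact Submodule.smul_mem _ _ (Submodule.subset_span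
          (Set.mem_insert_of_mem _ ⟨⟨i, hi⟩, rfl⟩))
    intro z hz
    have := congrArg Z.subtype (v.sum_repr ⟨z, hz⟩)
    rw [map_sum] at this
    change _ = z at this
    rw [← this]
    exact Submodule.sum_mem _ fun i _ => Submodule.smul_mem _ _ (hmem i)

omit [IsAlgClosed k] [CharZero k] in
theorem span_eq_maximalIdeal {ι : Type*} {e : ι → A} (h : IsFrame s t x y) (ht : 2 ≤ t)
    (hts : t + 1 ≤ s)
    (hsoc : ∀ a : A, (∀ b ∈ maximalIdeal A, b * a = 0) → ∃ c : k, a = c • x ^ s)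
    (he : IsOrthonormalComplement s x y e)
    (hZ : annihilatorOfPair k x y ≤ Submodule.span k (insert (x ^ s) (Set.range e))) :
    maximalIdeal A = Ideal.span (insert x (insert y (Set.range e))) := by
  set G := insert x (insert y (Set.range e)) with hG
  have hx : x ∈ Ideal.span G := Ideal.subset_span (by simp [hG])
  have hy : y ∈ Ideal.span G := Ideal.subset_span (by simp [hG])
  have hei : ∀ i, e i ∈ Ideal.span G := fun i => Ideal.subset_span (by simp [hG])
  apply le_antisymm
  · intro a ha
    obtain ⟨b, c, z, hz, hxz, hyz, rfl⟩ := h.exists_mul_eq_zero ht hts hsoc ha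
    refine add_mem (add_mem (Ideal.mul_mem_left _ _ hx) (Ideal.mul_mem_left _ _ hy)) ?_
    have h2 : Submodule.span k (insert (x ^ s) (Set.range e)) ≤
        (Ideal.span G).restrictScalars k := by
      rw [Submodule.span_le]
      rintro _ (rfl | ⟨i, rfl⟩)
      · exact Ideal.pow_mem_of_mem _ hx s (by omega)
      · exact hei i
    exact h2 (hZ (mem_annihilatorOfPair.2 ⟨hz, hxz, hyz⟩))
  · rw [Ideal.span_le]
    rintro _ (rfl | rfl | ⟨i, rfl⟩)
    exacts [h.left_mem, h.right_mem, he.mem i]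

omit [IsAlgClosed k] [CharZero k] in
/-- The elements `1`, `x`, `y` and the `e i` form a basis of `A / m ^ 2`. -/
theorem card_add_three [Module.Finite k A] {ι : Type*} [Fintype ι] {e : ι → A}
    (h : IsFrame s t x y) (ht : 2 ≤ t) (hts : t + 1 ≤ s)
    (hres : ∀ a : A, ∃ c : k, a - algebraMap k A c ∈ maximalIdeal A)
    (hsoc : ∀ a : A, (∀ b ∈ maximalIdeal A, b * a = 0) → ∃ c : k, a = c • x ^ s)
    (he : IsOrthonormalComplement s x y e)
    (hZ : annihilatorOfPair k x y ≤ Submodule.span k (insert (x ^ s) (Set.range e))) :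
    Module.finrank k A = Fintype.card ι + 3 +
      Module.finrank k ((maximalIdeal A ^ 2).restrictScalars k) := by
  set m := maximalIdeal A with hm
  let N := (m ^ 2).restrictScalars k
  let F : Fin 3 ⊕ ι → A := Sum.elim ![1, x, y] e
  have hli : LinearIndependent k (fun i => N.mkQ (F i)) := by
    rw [Fintype.linearIndependent_iff]
    intro g hg
    simp only [← map_smul, ← map_sum] at hg
    rw [Submodule.mkQ_apply, Submodule.Quotient.mk_eq_zero, Fintype.sum_sum_type,
      Fin.sum_univ_three] at hg
    simp only [F, Sum.elim_inl, Sum.elim_inr, Matrix.cons_val_zero, Matrix.cons_val_one,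
      Matrix.cons_val_two, Matrix.head_cons, Matrix.tail_cons] at hg
    set S := ∑ i, g (Sum.inr i) • e i with hS
    have hSx : x * S = 0 := by
      rw [hS, Finset.mul_sum]
      exact Finset.sum_eq_zero fun i _ => by rw [mul_smul_comm, he.left_mul, smul_zero]
    have hSm : S ∈ m.restrictScalars k := Submodule.sum_mem _ fun i _ =>
      Submodule.smul_mem _ _ (he.mem i)
    have hg' : g (Sum.inl 0) • (1 : A) + g (Sum.inl 1) • x + g (Sum.inl 2) • y + S ∈ m ^ 2 := hg
    simp only [Algebra.smul_def] at hg'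
    have hm' : S ∈ m := hSm
    have h0 : g (Sum.inl 0) = 0 := by
      by_contra hne
      have h1 : algebraMap k A (g (Sum.inl 0)) ∈ m := by
        have := m.sub_mem (Ideal.pow_le_self two_ne_zero hg') (m.add_mem (m.add_mem
          (m.mul_mem_left (algebraMap k A (g (Sum.inl 1))) h.left_mem)
          (m.mul_mem_left (algebraMap k A (g (Sum.inl 2))) h.right_mem)) hm')
        convert this using 1
        ring
      exact (IsLocalRing.mem_maximalIdeal _).1 h1 ((IsUnit.mk0 _ hne).map (algebraMap k A))
    rw [h0, map_zero, zero_mul, zero_add] at hg'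
    have hinr : ∀ j, g (Sum.inr j) = 0 := by
      intro j
      have h1 := h.mul_eq_zero_of_mem_sq hg' (he.left_mul j)
      have h2 : e j * S = g (Sum.inr j) • x ^ s := by
        rw [hS, Finset.mul_sum, Finset.sum_eq_single j]
        · rw [mul_smul_comm, ← pow_two, he.mul_self]
        · intro i _ hij
          rw [mul_smul_comm, he.mul_of_ne _ _ hij.symm, smul_zero]
        · simp
      have h3 : g (Sum.inr j) • x ^ s = 0 := by
        rw [← h2]
        linear_combination h1 - algebraMap k A (g (Sum.inl 1)) * he.left_mul j -
          algebraMap k A (g (Sum.inl 2)) * he.right_mul j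
      exact (smul_eq_zero.1 h3).resolve_right h.pow_ne_zero
    have hS0 : S = 0 := by rw [hS]; exact Finset.sum_eq_zero fun i _ => by rw [hinr, zero_smul]
    rw [hS0, add_zero] at hg'
    have hmulmem : ∀ (j : ℕ) {w : A}, w ∈ m ^ 2 → x ^ j * w ∈ m ^ (j + 2) := fun j w hw => by
      rw [pow_add]; exact Ideal.mul_mem_mul (Ideal.pow_mem_pow h.left_mem _) hw
    have h1 : g (Sum.inl 1) = 0 := by
      have h2 := hmulmem (s - 1) hg'
      rw [show s - 1 + 2 = s + 1 by omega, hm, h.pow_eq_bot, Ideal.mem_bot] at h2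
      have h3 : g (Sum.inl 1) • x ^ s = 0 := by
        rw [Algebra.smul_def]
        have h4 := h.pow_mul_eq_zero_of_le (show t ≤ s - 1 by omega)
        have h5 : x ^ s = x ^ (s - 1) * x := by rw [← pow_succ, show s - 1 + 1 = s by omega]
        rw [h5]
        linear_combination h2 - algebraMap k A (g (Sum.inl 2)) * h4
      exact (smul_eq_zero.1 h3).resolve_right h.pow_ne_zero
    rw [h1, map_zero, zero_mul, zero_add] at hg'
    have h2 : g (Sum.inl 2) = 0 := by
      by_contra hne
      refine h.pow_mul_notMem ?_
      have h2 := hmulmem (t - 1) hg'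
      rw [show t - 1 + 2 = t + 1 by omega] at h2
      rw [← Ideal.unit_mul_mem_iff_mem _ ((IsUnit.mk0 _ hne).map (algebraMap k A))]
      convert h2 using 1
      ring
    rintro (i | j)
    · fin_cases i
      exacts [h0, h1, h2]
    · exact hinr j
  have hspan : ⊤ ≤ Submodule.span k (Set.range fun i => N.mkQ (F i)) := by
    have hP : Submodule.span k (Set.range F) ⊔ N = ⊤ := by
      set P := Submodule.span k (Set.range F) ⊔ N
      have hF : ∀ i, F i ∈ P := fun i => Submodule.mem_sup_left (Submodule.subset_span ⟨i, rfl⟩)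
      have hN : ∀ w ∈ m ^ 2, w ∈ P := fun w hw => Submodule.mem_sup_right hw
      have hmul : ∀ a b, b ∈ m → b ∈ P → a * b ∈ P := by
        intro a b hb hbP
        obtain ⟨c, hc⟩ := hres a
        have : a * b = (a - algebraMap k A c) * b + c • b := by rw [Algebra.smul_def]; ring
        rw [this]
        exact P.add_mem (hN _ (mul_mem_sq hc hb)) (P.smul_mem _ hbP)
      rw [eq_top_iff]
      rintro a -
      obtain ⟨c, hc⟩ := hres a
      obtain ⟨b, d, z, hz, hxz, hyz, habz⟩ := h.exists_mul_eq_zero ht hts hsoc hc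
      have : a = c • F (Sum.inl 0) + b * x + d * y + z := by
        rw [Algebra.smul_def]
        change a = algebraMap k A c * 1 + b * x + d * y + z
        linear_combination habz
      rw [this]
      refine P.add_mem (P.add_mem (P.add_mem (P.smul_mem _ (hF _))
        (hmul _ _ h.left_mem (hF (Sum.inl 1)))) (hmul _ _ h.right_mem (hF (Sum.inl 2)))) ?_
      have h2 : Submodule.span k (insert (x ^ s) (Set.range e)) ≤ P := by
        rw [Submodule.span_le]
        rintro _ (rfl | ⟨i, rfl⟩)
        · exact hN _ (Ideal.pow_le_pow_right (by omega) (Ideal.pow_mem_pow h.left_mem s))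
        · exact hF (Sum.inr i)
      exact h2 (hZ (mem_annihilatorOfPair.2 ⟨hz, hxz, hyz⟩))
    rw [Set.range_comp' N.mkQ F, Submodule.span_image, top_le_iff, ← Submodule.range_mkQ N,
      ← Submodule.map_top, ← hP, Submodule.map_sup, Submodule.mkQ_map_self, sup_bot_eq]
  have h1 := Submodule.finrank_quotient_add_finrank N
  have h2 := Module.finrank_eq_card_basis (Module.Basis.mk hli hspan)
  rw [Fintype.card_sum, Fintype.card_fin] at h2
  have h3 : Module.finrank k N = Module.finrank k ((m ^ 2).restrictScalars k) := rfl
  omega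

end IsFrame

end Complement

/-! ### Quotients of power series rings -/

section PowerSeriesQuotient

variable {k : Type*} [Field k] {h : ℕ}

theorem MvPowerSeries.mem_span_range_X_of_constantCoeff_eq_zero {f : MvPowerSeries (Fin h) k}
    (hf : constantCoeff f = 0) :
    f ∈ Ideal.span (Set.range (X : Fin h → MvPowerSeries (Fin h) k)) := by
  classical
  -- `g i * X i` collects the monomials whose first variable is `X i`.
  let g : Fin h → MvPowerSeries (Fin h) k := fun i n =>
    if ∀ j < i, n j = 0 then coeff (n + Finsupp.single i 1) f else 0
  have hg : ∀ i n, coeff n (g i) =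
      if ∀ j < i, n j = 0 then coeff (n + Finsupp.single i 1) f else 0 := fun i n => rfl
  have hsum : f = ∑ i, g i * X i := by
    ext n
    rw [map_sum]
    have hterm : ∀ i, coeff n (g i * X i) =
        if n i ≠ 0 ∧ ∀ j < i, n j = 0 then coeff n f else 0 := by
      intro i
      rw [X_def, coeff_mul_monomial, mul_one]
      by_cases hi : n i = 0
      · rw [if_neg, if_neg (by simp [hi])]
        intro hle
        have := hle i
        simp [hi] at this
      · have hle : Finsupp.single i 1 ≤ n := by
          rw [Finsupp.single_le_iff]; omega
        rw [if_pos hle, hg, tsub_add_cancel_of_le hle]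
        have : (∀ j < i, (n - Finsupp.single i 1 : Fin h →₀ ℕ) j = 0) ↔ ∀ j < i, n j = 0 :=
          forall₂_congr fun j hj => by
            rw [Finsupp.tsub_apply, Finsupp.single_eq_of_ne hj.ne, tsub_zero]
        rw [if_congr this rfl rfl]
        simp [hi]
    simp only [hterm]
    rcases eq_or_ne n 0 with rfl | hn
    · simpa using hf
    · have hne : (Finset.univ.filter fun i => n i ≠ 0).Nonempty := by
        obtain ⟨i, hi⟩ := Finsupp.ne_iff.1 hn
        exact ⟨i, by simpa using hi⟩
      set i₀ := Finset.min' _ hne with hi₀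
      have hmem := Finset.min'_mem _ hne
      rw [Finset.mem_filter, ← hi₀] at hmem
      have hlt : ∀ j < i₀, n j = 0 := by
        intro j hj
        by_contra hne'
        exact absurd (Finset.min'_le _ j (Finset.mem_filter.2 ⟨Finset.mem_univ _, hne'⟩))
          (not_le.2 hj)
      rw [Finset.sum_eq_single i₀, if_pos ⟨hmem.2, hlt⟩]
      · intro i _ hi
        rw [if_neg]
        rintro ⟨h1, h2⟩
        rcases lt_or_gt_of_ne hi with h3 | h3
        · exact h1 (hlt i h3)
        · exact hmem.2 (h2 _ h3)
      · simp
  rw [hsum]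
  exact Ideal.sum_mem _ fun i _ => Ideal.mul_mem_left _ _ (Ideal.subset_span ⟨i, rfl⟩)

variable {I : Ideal (MvPowerSeries (Fin h) k)} [IsLocalRing (MvPowerSeries (Fin h) k ⧸ I)]

theorem mk_mem_maximalIdeal_iff {f : MvPowerSeries (Fin h) k} :
    Ideal.Quotient.mk I f ∈ maximalIdeal (MvPowerSeries (Fin h) k ⧸ I) ↔
      MvPowerSeries.constantCoeff f = 0 := by
  rw [IsLocalRing.mem_maximalIdeal, mem_nonunits_iff]
  constructor
  · intro hf
    by_contra h0
    exact hf ((MvPowerSeries.isUnit_iff_constantCoeff.2 (isUnit_iff_ne_zero.2 h0)).map _)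
  · intro h0 hf
    obtain ⟨b, hb⟩ := hf.exists_right_inv
    obtain ⟨g, rfl⟩ := Ideal.Quotient.mk_surjective b
    rw [← map_mul, ← map_one (Ideal.Quotient.mk I), Ideal.Quotient.eq] at hb
    have hu : IsUnit (f * g - 1) := MvPowerSeries.isUnit_iff_constantCoeff.2 (by simp [h0])
    have htop := Ideal.eq_top_of_isUnit_mem I hb hu
    exact Ideal.Quotient.nontrivial_iff.1 inferInstance htop

theorem exists_sub_algebraMap_mem_maximalIdeal (a : MvPowerSeries (Fin h) k ⧸ I) :
    ∃ c : k, a - algebraMap k _ c ∈ maximalIdeal (MvPowerSeries (Fin h) k ⧸ I) := by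
  obtain ⟨f, rfl⟩ := Ideal.Quotient.mk_surjective a
  refine ⟨MvPowerSeries.constantCoeff f, ?_⟩
  change Ideal.Quotient.mk I f - Ideal.Quotient.mk I (MvPowerSeries.C _) ∈ _
  rw [← map_sub, mk_mem_maximalIdeal_iff]
  simp

/-- Lift the images to power series without constant term and substitute. -/
theorem exists_algHom_apply_X {Y : Fin h → MvPowerSeries (Fin h) k ⧸ I}
    (hY : ∀ i, Y i ∈ maximalIdeal (MvPowerSeries (Fin h) k ⧸ I)) :
    ∃ φ : MvPowerSeries (Fin h) k →ₐ[k] MvPowerSeries (Fin h) k ⧸ I,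
      ∀ i, φ (MvPowerSeries.X i) = Y i := by
  choose f hf using fun i => Ideal.Quotient.mk_surjective (Y i)
  have hsub : MvPowerSeries.HasSubst f := MvPowerSeries.hasSubst_of_constantCoeff_zero fun i =>
    mk_mem_maximalIdeal_iff.1 ((hf i).symm ▸ hY i)
  refine ⟨(Ideal.Quotient.mkₐ k I).comp (MvPowerSeries.substAlgHom hsub), fun i => ?_⟩
  rw [AlgHom.comp_apply, MvPowerSeries.substAlgHom_X, Ideal.Quotient.mkₐ_eq_mk, hf]

end PowerSeriesQuotient

/-! ### Spanning the model algebras -/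

section ModelAlgebra

open Polynomial

variable {k B : Type*} [Field k] [CommRing B] [Algebra k B]

/-- The generators of the model ideal `I_{p,q(x_1)}`, as relations between elements `x`, `y`, `e i`
of an arbitrary `k`-algebra. -/
structure ModelRelations (s t p : ℕ) (q : k[X]) {r : ℕ} (x y : B) (e : Fin r → B) : Prop where
  pow_mul : x ^ t * y = 0
  sq_right : y ^ 2 = x ^ (p + 1) * y + aeval x q * x ^ (s - t + 1)
  left_mul : ∀ i, x * e i = 0
  right_mul : ∀ i, y * e i = 0
  mul_self : ∀ i, e i ^ 2 = x ^ s
  mul_of_ne : ∀ i j, i ≠ j → e i * e j = 0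

namespace ModelRelations

variable {s t p r : ℕ} {q : k[X]} {x y : B} {e : Fin r → B}

theorem pow_succ_eq_zero (h : ModelRelations s t p q x y e) (hts : t ≤ s)
    (hq : IsUnit (aeval x q)) : x ^ (s + 1) = 0 := by
  refine hq.mul_right_eq_zero.1 ?_
  rw [show s + 1 = s - t + 1 + t by omega, pow_add]
  linear_combination -x ^ t * h.sq_right + (y - x ^ (p + 1)) * h.pow_mul

theorem isNilpotent (h : ModelRelations s t p q x y e) (hx : x ^ (s + 1) = 0) (hs : 0 < s) :
    IsNilpotent (Ideal.span (Set.range (Fin.cons x (Fin.cons y e) : Fin (r + 2) → B))) := by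
  rw [Ideal.FG.isNilpotent_iff_le_nilradical (Submodule.fg_span (Set.finite_range _)),
    Ideal.span_le]
  have hxn : x ∈ nilradical B := ⟨s + 1, hx⟩
  rintro _ ⟨i, rfl⟩
  induction i using Fin.cases with
  | zero => exact hxn
  | succ i =>
    induction i using Fin.cases with
    | zero =>
      have : y ^ 2 ∈ nilradical B := by
        rw [h.sq_right, pow_succ, pow_succ]
        exact add_mem (Ideal.mul_mem_right _ _ (Ideal.mul_mem_left _ _ hxn))
          (Ideal.mul_mem_left _ _ (Ideal.mul_mem_left _ _ hxn))
      exact mem_nilradical.2 (mem_nilradical.1 this).of_pow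
    | succ i =>
      refine ⟨3, ?_⟩
      change e i ^ 3 = 0
      rw [pow_succ, h.mul_self, show s = s - 1 + 1 by omega, pow_succ, mul_assoc, h.left_mul,
        mul_zero]

/-- The `s + 1 + t + r` monomials `x ^ i` with `i ≤ s`, `x ^ i y` with `i < t`, and `e i` span. -/
theorem finite_and_finrank_le (h : ModelRelations s t p q x y e) (hx : x ^ (s + 1) = 0)
    (hs : 0 < s) (hA : ∀ a : B, ∃ c : k, a - algebraMap k B c ∈
      Ideal.span (Set.range (Fin.cons x (Fin.cons y e) : Fin (r + 2) → B))) :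
    Module.Finite k B ∧ Module.finrank k B ≤ s + 1 + t + r := by
  set Y : Fin (r + 2) → B := Fin.cons x (Fin.cons y e) with hY
  let b : (Fin (s + 1) ⊕ Fin t) ⊕ Fin r → B :=
    Sum.elim (Sum.elim (fun i => x ^ (i : ℕ)) fun i => x ^ (i : ℕ) * y) e
  set S := Submodule.span k (Set.range b) with hS
  have hb : ∀ i, b i ∈ S := fun i => Submodule.subset_span ⟨i, rfl⟩
  have hX : ∀ j, x ^ j ∈ S := by
    intro j
    by_cases hj : j < s + 1
    · exact hb (Sum.inl (Sum.inl ⟨j, hj⟩))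
    · rw [pow_eq_zero_of_le (by omega) hx]; exact S.zero_mem
  have hXY : ∀ j, x ^ j * y ∈ S := by
    intro j
    by_cases hj : j < t
    · exact hb (Sum.inl (Sum.inr ⟨j, hj⟩))
    · rw [show j = j - t + t by omega, pow_add, mul_assoc, h.pow_mul, mul_zero]; exact S.zero_mem
  have hXq : ∀ j, aeval x q * x ^ j ∈ S := by
    intro j
    rw [aeval_eq_sum_range, Finset.sum_mul]
    refine S.sum_mem fun i _ => ?_
    rw [smul_mul_assoc, ← pow_add]
    exact S.smul_mem _ (hX _)
  have hmul : ∀ a ∈ S, ∀ i, a * Y i ∈ S := by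
    intro a ha i
    suffices hle : S ≤ S.comap (LinearMap.mulRight k (Y i)) from hle ha
    rw [hS, Submodule.span_le, ← hS]
    rintro _ ⟨j, rfl⟩
    change b j * Y i ∈ S
    induction i using Fin.cases with
    | zero =>
      change b j * x ∈ S
      rcases j with (j | j) | j
      · change x ^ (j : ℕ) * x ∈ S
        rw [← pow_succ]; exact hX _
      · change x ^ (j : ℕ) * y * x ∈ S
        rw [mul_right_comm, ← pow_succ]; exact hXY _
      · change e j * x ∈ S
        rw [mul_comm, h.left_mul]; exact S.zero_mem
    | succ i =>
      induction i using Fin.cases with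
      | zero =>
        change b j * y ∈ S
        rcases j with (j | j) | j
        · exact hXY _
        · change x ^ (j : ℕ) * y * y ∈ S
          have : x ^ (j : ℕ) * y * y =
              x ^ (j + (p + 1)) * y + aeval x q * x ^ (j + (s - t + 1)) := by
            rw [pow_add, pow_add]
            linear_combination x ^ (j : ℕ) * h.sq_right
          rw [this]
          exact S.add_mem (hXY _) (hXq _)
        · change e j * y ∈ S
          rw [mul_comm, h.right_mul]; exact S.zero_mem
      | succ i =>
        change b j * e i ∈ S
        rcases j with (j | j) | j
        · change x ^ (j : ℕ) * e i ∈ S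
          obtain ⟨j, hj⟩ := j
          cases j with
          | zero => rw [pow_zero, one_mul]; exact hb (Sum.inr i)
          | succ j => rw [pow_succ, mul_assoc, h.left_mul, mul_zero]; exact S.zero_mem
        · change x ^ (j : ℕ) * y * e i ∈ S
          rw [mul_assoc, h.right_mul, mul_zero]; exact S.zero_mem
        · change e j * e i ∈ S
          by_cases hij : j = i
          · rw [hij, ← pow_two, h.mul_self]; exact hX _
          · rw [h.mul_of_ne _ _ hij]; exact S.zero_mem
  obtain ⟨N, hN⟩ := h.isNilpotent hx hs
  have htop : S = ⊤ := by
    refine eq_top_of_mul_generators_mem Y _ hN (fun i => Ideal.subset_span ⟨i, rfl⟩) (fun a => ?_)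
      S (by simpa using hX 0) hmul
    obtain ⟨c, hc⟩ := hA a
    obtain ⟨d, hd⟩ := Submodule.mem_span_range_iff_exists_fun B |>.1 hc
    exact ⟨c, d, by simp only [smul_eq_mul] at hd; rw [hd]; ring⟩
  refine ⟨⟨htop ▸ Submodule.fg_span (Set.finite_range b)⟩, ?_⟩
  have := finrank_range_le_card (R := k) b
  rw [Set.finrank, ← hS, htop, finrank_top] at this
  simpa using this

end ModelRelations

end ModelAlgebra

/-! ### Comparison with the model algebra -/

section Comparison

open Polynomial

variable {k : Type*} [Field k] {s t p r : ℕ}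

theorem modelRelations_quotient_modelIdeal (hh : 2 ≤ r + 2) (q : k[X]) :
    ModelRelations s t p q
      (Ideal.Quotient.mk (modelIdeal hh s t p (aeval (x₁ k hh) q)) (MvPowerSeries.X 0))
      (Ideal.Quotient.mk _ (MvPowerSeries.X 1))
      (fun i : Fin r => Ideal.Quotient.mk _ (MvPowerSeries.X i.succ.succ)) := by
  set J := modelIdeal hh s t p (aeval (x₁ k hh) q) with hJ
  have hx₁ : x₁ k hh = MvPowerSeries.X 0 := rfl
  have hx₂ : x₂ k hh = MvPowerSeries.X 1 := rfl
  have hmixed : ∀ i j : Fin (r + 2), i < j → ¬ (i.val = 0 ∧ j.val = 1) →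
      Ideal.Quotient.mk J (MvPowerSeries.X i) * Ideal.Quotient.mk J (MvPowerSeries.X j) = 0 := by
    intro i j hij hne
    rw [← map_mul, Ideal.Quotient.eq_zero_iff_mem]
    exact Ideal.subset_span (Or.inl (Or.inl ⟨i, j, hij, hne, rfl⟩))
  refine ⟨?_, ?_, fun i => hmixed _ _ (Fin.succ_pos _) (by simp), fun i => hmixed _ _ ?_ (by simp),
    fun i => ?_, fun i j hij => ?_⟩
  · rw [← map_pow, ← map_mul, Ideal.Quotient.eq_zero_iff_mem]
    exact Ideal.subset_span (Or.inr (Or.inr rfl))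
  · have h1 : aeval (Ideal.Quotient.mk J (MvPowerSeries.X 0)) q =
        Ideal.Quotient.mk J (aeval (x₁ k hh) q) := by
      rw [hx₁]
      exact aeval_algHom_apply (Ideal.Quotient.mkₐ k J) _ q
    rw [h1, ← sub_eq_zero, ← sub_sub]
    simp only [← map_pow, ← map_mul, ← map_sub]
    rw [Ideal.Quotient.eq_zero_iff_mem]
    exact Ideal.subset_span (Or.inr (Or.inl rfl))
  · exact Fin.succ_lt_succ_iff.2 (Fin.succ_pos i)
  · rw [← sub_eq_zero, ← map_pow, ← map_pow, ← map_sub, Ideal.Quotient.eq_zero_iff_mem]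
    exact Ideal.subset_span (Or.inl (Or.inr ⟨i.succ.succ, by simp, rfl⟩))
  · rcases lt_or_gt_of_ne hij with hlt | hlt
    · exact hmixed _ _ (by simpa using hlt) (by simp)
    · rw [mul_comm]
      exact hmixed _ _ (by simpa using hlt) (by simp)

theorem finite_and_finrank_quotient_modelIdeal_le (hh : 2 ≤ r + 2) (hts : t ≤ s) (hs : 0 < s)
    {q : k[X]} (hq : q.coeff 0 ≠ 0) :
    Module.Finite k (MvPowerSeries (Fin (r + 2)) k ⧸ modelIdeal hh s t p (aeval (x₁ k hh) q)) ∧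
    Module.finrank k (MvPowerSeries (Fin (r + 2)) k ⧸ modelIdeal hh s t p (aeval (x₁ k hh) q)) ≤
      s + 1 + t + r := by
  set J := modelIdeal hh s t p (aeval (x₁ k hh) q) with hJ
  have h := modelRelations_quotient_modelIdeal (s := s) (t := t) (p := p) hh q
  have hunit : IsUnit (aeval (Ideal.Quotient.mk J (MvPowerSeries.X 0)) q) := by
    have h1 : aeval (Ideal.Quotient.mk J (MvPowerSeries.X 0)) q =
        Ideal.Quotient.mk J (aeval (MvPowerSeries.X 0) q) :=
      aeval_algHom_apply (Ideal.Quotient.mkₐ k J) _ q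
    rw [h1]
    refine IsUnit.map _ (MvPowerSeries.isUnit_iff_constantCoeff.2 (isUnit_iff_ne_zero.2 ?_))
    have h2 : MvPowerSeries.constantCoeff (aeval (MvPowerSeries.X (0 : Fin (r + 2))) q) =
        q.coeff 0 := by
      rw [aeval_def, hom_eval₂, MvPowerSeries.constantCoeff_X, eval₂_at_zero]
      rfl
    rwa [h2]
  refine h.finite_and_finrank_le (h.pow_succ_eq_zero hts hunit) hs fun a => ?_
  obtain ⟨f, rfl⟩ := Ideal.Quotient.mk_surjective a
  refine ⟨MvPowerSeries.constantCoeff f, ?_⟩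
  have h1 : f - MvPowerSeries.C (MvPowerSeries.constantCoeff f) ∈
      Ideal.span (Set.range (MvPowerSeries.X : Fin (r + 2) → MvPowerSeries (Fin (r + 2)) k)) :=
    MvPowerSeries.mem_span_range_X_of_constantCoeff_eq_zero (by simp)
  have h2 := Ideal.mem_map_of_mem (Ideal.Quotient.mk J) h1
  rw [Ideal.map_span, ← Set.range_comp, map_sub] at h2
  have h3 : (Ideal.Quotient.mk J : _ → _) ∘ MvPowerSeries.X =
      (Fin.cons (Ideal.Quotient.mk J (MvPowerSeries.X 0))
        (Fin.cons (Ideal.Quotient.mk J (MvPowerSeries.X 1)) fun i : Fin r =>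
          Ideal.Quotient.mk J (MvPowerSeries.X i.succ.succ)) : Fin (r + 2) → _) := by
    funext i
    induction i using Fin.cases with
    | zero => rfl
    | succ i =>
      induction i using Fin.cases with
      | zero => rfl
      | succ i => rfl
  rwa [h3] at h2

/-- The model algebra surjects onto `R / I`, and its dimension is at most that of `R / I`. -/
theorem idealIso_modelIdeal {I : Ideal (MvPowerSeries (Fin (r + 2)) k)}
    [IsLocalRing (MvPowerSeries (Fin (r + 2)) k ⧸ I)] (hh : 2 ≤ r + 2) (hts : t ≤ s) (hs : 0 < s)
    {q : k[X]} (hq : q.coeff 0 ≠ 0) {x y : MvPowerSeries (Fin (r + 2)) k ⧸ I}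
    {e : Fin r → MvPowerSeries (Fin (r + 2)) k ⧸ I}
    (hnil : IsNilpotent (maximalIdeal (MvPowerSeries (Fin (r + 2)) k ⧸ I)))
    (hrel : ModelRelations s t p q x y e)
    (hspan : maximalIdeal (MvPowerSeries (Fin (r + 2)) k ⧸ I) =
      Ideal.span (insert x (insert y (Set.range e))))
    (hfin : Module.finrank k (MvPowerSeries (Fin (r + 2)) k ⧸ I) = s + 1 + t + r) :
    IdealIso I (modelIdeal hh s t p (aeval (x₁ k hh) q)) := by
  set J := modelIdeal hh s t p (aeval (x₁ k hh) q) with hJ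
  let Y : Fin (r + 2) → MvPowerSeries (Fin (r + 2)) k ⧸ I := Fin.cons x (Fin.cons y e)
  have hrange : Set.range Y = insert x (insert y (Set.range e)) := by
    simp only [Y, Fin.range_cons]
  rw [← hrange] at hspan
  have hY : ∀ i, Y i ∈ maximalIdeal (MvPowerSeries (Fin (r + 2)) k ⧸ I) := fun i => by
    rw [hspan]; exact Ideal.subset_span ⟨i, rfl⟩
  obtain ⟨φ, hφ⟩ := exists_algHom_apply_X hY
  have hφ0 : φ (x₁ k hh) = x := hφ 0
  have hφ1 : φ (x₂ k hh) = y := hφ 1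
  have hker : ∀ f ∈ J, φ f = 0 := by
    have hle : J ≤ RingHom.ker φ := by
      rw [hJ, modelIdeal, Ideal.span_le]
      rintro _ ((⟨i, j, hij, hne, rfl⟩ | ⟨j, hj, rfl⟩) | rfl | rfl)
      · change φ _ = 0
        rw [map_mul, hφ, hφ]
        induction i using Fin.cases with
        | zero =>
          induction j using Fin.cases with
          | zero => exact absurd hij (lt_irrefl _)
          | succ j =>
            induction j using Fin.cases with
            | zero => exact absurd ⟨rfl, rfl⟩ hne
            | succ j => exact hrel.left_mul j
        | succ i =>
          induction j using Fin.cases with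
          | zero => exact absurd hij (Fin.not_lt_zero _)
          | succ j =>
            induction j using Fin.cases with
            | zero => exact absurd (Fin.succ_lt_succ_iff.1 hij) (Fin.not_lt_zero _)
            | succ j =>
              induction i using Fin.cases with
              | zero => exact hrel.right_mul j
              | succ i =>
                refine hrel.mul_of_ne i j ?_
                rintro rfl
                exact lt_irrefl _ hij
      · change φ _ = 0
        rw [map_sub, map_pow, map_pow, hφ, hφ0, sub_eq_zero]
        obtain ⟨j, rfl⟩ : ∃ i : Fin r, j = i.succ.succ :=
          ⟨⟨j.val - 2, by omega⟩, Fin.ext (by simp; omega)⟩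
        exact hrel.mul_self j
      · change φ _ = 0
        have : φ (aeval (x₁ k hh) q) = aeval x q := by rw [← hφ0, aeval_algHom_apply]
        simp only [map_sub, map_mul, map_pow, hφ0, hφ1, this]
        linear_combination hrel.sq_right
      · change φ _ = 0
        rw [map_mul, map_pow, hφ0, hφ1, hrel.pow_mul]
    exact fun f hf => hle hf
  let ψ := Ideal.Quotient.liftₐ J φ hker
  obtain ⟨hJfin, hJle⟩ := finite_and_finrank_quotient_modelIdeal_le (p := p) hh hts hs hq
  have hsurj : Function.Surjective ψ := by
    obtain ⟨N, hN⟩ := hnil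
    have htop := eq_top_of_mul_generators_mem Y _ hN hY (fun a => by
      obtain ⟨c, hc⟩ := exists_sub_algebraMap_mem_maximalIdeal (I := I) a
      rw [hspan] at hc
      obtain ⟨d, hd⟩ := Submodule.mem_span_range_iff_exists_fun _ |>.1 hc
      exact ⟨c, d, by simp only [smul_eq_mul] at hd; rw [hd]; ring⟩)
      (Subalgebra.toSubmodule ψ.range) (one_mem ψ.range)
      (fun a ha i => mul_mem (S := Subalgebra k _) ha
        ⟨Ideal.Quotient.mk J (MvPowerSeries.X i), hφ i⟩)
    intro a
    have : a ∈ Subalgebra.toSubmodule ψ.range := htop ▸ Submodule.mem_top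
    exact this
  rw [← hJ] at hJle
  have hge := ψ.toLinearMap.finrank_le_finrank_of_surjective hsurj
  have hinj : Function.Injective ψ := by
    have : Module.Finite k (MvPowerSeries (Fin (r + 2)) k ⧸ I) :=
      Module.Finite.of_surjective ψ.toLinearMap hsurj
    exact (LinearMap.injective_iff_surjective_of_finrank_eq_finrank (f := ψ.toLinearMap)
      (by omega)).2 hsurj
  exact ⟨(AlgEquiv.ofBijective ψ ⟨hinj, hsurj⟩).symm⟩

end Comparison

/-! ### Existence of the isomorphism -/

section Main

theorem finrank_sq_eq {k A : Type*} [Field k] [CommRing A] [Algebra k A] [IsLocalRing A]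
    [Module.Finite k A] (hres : ∀ a : A, ∃ c : k, a - algebraMap k A c ∈ maximalIdeal A) {s t : ℕ}
    (ht : 1 ≤ t) (hts : t ≤ s) (hbot : maximalIdeal A ^ (s + 1) = ⊥)
    (h2 : ∀ j, 2 ≤ j → j ≤ t → hilbertFn A j = 2)
    (h1 : ∀ j, t + 1 ≤ j → j ≤ s → hilbertFn A j = 1) :
    Module.finrank k ((maximalIdeal A ^ 2).restrictScalars k) = s - t + 2 * (t - 1) := by
  have hfr := finrank_pow_eq_hilbertFn_add (k := k) hres
  have hhigh : ∀ n ≤ s - t,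
      Module.finrank k ((maximalIdeal A ^ (s + 1 - n)).restrictScalars k) = n := by
    intro n
    induction n with
    | zero =>
      intro _
      rw [Nat.sub_zero, hbot, Submodule.restrictScalars_bot, finrank_bot]
    | succ n ih =>
      intro hn
      have h3 := hfr (s + 1 - (n + 1))
      rw [h1 _ (by omega) (by omega), show s + 1 - (n + 1) + 1 = s + 1 - n by omega,
        ih (by omega)] at h3
      omega
  have hlow : ∀ n ≤ t - 1,
      Module.finrank k ((maximalIdeal A ^ (t + 1 - n)).restrictScalars k) = s - t + 2 * n := by
    intro n
    induction n with
    | zero =>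
      intro _
      have := hhigh (s - t) le_rfl
      rwa [show s + 1 - (s - t) = t + 1 - 0 by omega] at this
    | succ n ih =>
      intro hn
      have h3 := hfr (t + 1 - (n + 1))
      rw [h2 _ (by omega) (by omega), show t + 1 - (n + 1) + 1 = t + 1 - n by omega,
        ih (by omega)] at h3
      omega
  have := hlow (t - 1) le_rfl
  rwa [show t + 1 - (t - 1) = 2 by omega] at this

theorem exists_eq_smul_of_isArtinianGorenstein {k A : Type*} [Field k] [CommRing A] [Algebra k A]
    [IsLocalRing A] (hgor : IsArtinianGorenstein A)
    (hres : ∀ a : A, ∃ c : k, a - algebraMap k A c ∈ maximalIdeal A) {v : A} (hv : v ≠ 0)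
    (hvm : ∀ b ∈ maximalIdeal A, b * v = 0) {a : A} (ha : ∀ b ∈ maximalIdeal A, b * a = 0) :
    ∃ c : k, a = c • v := by
  have := hgor.2
  obtain ⟨b, hb⟩ := (IsSimpleModule.toSpanSingleton_surjective A (m := (⟨v, hvm⟩ : localSocle A))
    (fun h => hv (congrArg Subtype.val h))) ⟨a, ha⟩
  obtain ⟨c, hc⟩ := hres b
  refine ⟨c, ?_⟩
  have hb' : b * v = a := congrArg Subtype.val hb
  rw [Algebra.smul_def, ← hb']
  linear_combination hvm _ hc

open Polynomial in
theorem exists_idealIso_modelIdeal {k : Type*} [Field k] [IsAlgClosed k] [CharZero k]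
    {h s t : ℕ} (hh : 2 ≤ h)
    {I : Ideal (MvPowerSeries (Fin h) k)} [IsLocalRing (MvPowerSeries (Fin h) k ⧸ I)]
    (hgor : IsArtinianGorenstein (MvPowerSeries (Fin h) k ⧸ I))
    (htype : HasType (MvPowerSeries (Fin h) k ⧸ I) h s t) :
    ∃ (p : ℕ) (q : k[X]), p < t ∧ IdealIso I (modelIdeal hh s t p (aeval (x₁ k hh) q)) ∧
      ((¬ IsCritical s t p ∧ q = 1) ∨ (IsCritical s t p ∧ ∃ c : k, c ≠ 0 ∧
        (q = C c ∨ ∃ d, 1 ≤ d ∧ d + p + 2 ≤ t ∧ q = C c + X ^ d))) := by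
  set A := MvPowerSeries (Fin h) k ⧸ I with hA
  have := hgor.1
  have hres : ∀ a : A, ∃ c : k, a - algebraMap k A c ∈ maximalIdeal A :=
    exists_sub_algebraMap_mem_maximalIdeal
  have : Module.Finite k A := moduleFinite_of_residue_surjective hres
  have ht : 2 ≤ t := by have := htype.three_le; omega
  have hts := htype.t_lt_s
  have hsoc : ∀ {x y : A}, IsFrame s t x y →
      ∀ a : A, (∀ b ∈ maximalIdeal A, b * a = 0) → ∃ c : k, a = c • x ^ s := by
    intro x y hf a ha
    refine exists_eq_smul_of_isArtinianGorenstein hgor hres hf.pow_ne_zero (fun b hb => ?_) ha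
    have := Ideal.mul_mem_mul hb (Ideal.pow_mem_pow hf.left_mem s)
    rwa [← pow_succ', hf.pow_eq_bot] at this
  have key : ∀ (p : ℕ) (q : k[X]) (x y : A), q.coeff 0 ≠ 0 → IsNormalFrame k s t p q x y →
      IdealIso I (modelIdeal hh s t p (aeval (x₁ k hh) q)) := by
    intro p q x y hq hf
    obtain ⟨ι, _, e, he, hZ⟩ :=
      hf.exists_isOrthonormalComplement ht hts (hsoc hf.toIsFrame)
    have hcard := hf.card_add_three ht hts hres (hsoc hf.toIsFrame) he hZ
    have hspan := hf.span_eq_maximalIdeal ht hts (hsoc hf.toIsFrame) he hZ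
    have hsq := finrank_sq_eq hres (by omega) (by omega) hf.pow_eq_bot htype.deg_two
      htype.deg_high
    have h0 := finrank_pow_eq_hilbertFn_add hres 0
    have h1 := finrank_pow_eq_hilbertFn_add hres 1
    rw [htype.deg_zero, pow_zero, Ideal.one_eq_top, Submodule.restrictScalars_top,
      finrank_top, zero_add] at h0
    rw [htype.deg_one, one_add_one_eq_two] at h1
    obtain ⟨r, hr⟩ : ∃ r, Fintype.card ι = r := ⟨_, rfl⟩
    obtain rfl : h = r + 2 := by omega
    let f := (Fintype.equivFinOfCardEq hr).symm
    refine idealIso_modelIdeal (e := e ∘ f) hh (by omega) (by omega) hq ⟨s + 1, hf.pow_eq_bot⟩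
      ⟨hf.pow_mul_eq_zero, hf.sq_right, fun i => he.left_mul _, fun i => he.right_mul _,
        fun i => he.mul_self _, fun i j hij => he.mul_of_ne _ _ (f.injective.ne hij)⟩ ?_
        (by change Module.finrank k A = _; omega)
    rw [EquivLike.range_comp]
    exact hspan
  obtain ⟨x₀, y₀, hf₀⟩ := exists_isFrame hres ht hts htype.deg_two htype.deg_high
    htype.deg_zero_of_gt
  obtain ⟨p, x, y, hp, ⟨hcrit, hf⟩ | ⟨hcrit, c, hc, hf | ⟨d, hd, hdt, hf⟩⟩⟩ :=
    hf₀.exists_isNormalFrame ht hts hres (hsoc hf₀)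
  · exact ⟨p, 1, hp, key _ _ _ _ (by simp) hf, Or.inl ⟨hcrit, rfl⟩⟩
  · exact ⟨p, C c, hp, key _ _ _ _ (by simpa using hc) hf, Or.inr ⟨hcrit, c, hc, Or.inl rfl⟩⟩
  · refine ⟨p, C c + X ^ d, hp, key _ _ _ _ ?_ hf, Or.inr ⟨hcrit, c, hc, Or.inr ⟨d, hd, hdt, rfl⟩⟩⟩
    rw [coeff_add, coeff_C_zero, coeff_X_pow, if_neg (by omega), add_zero]
    exact hc

end Main

theorem theorem2p6 {k : Type*} [Field k] [IsAlgClosed k] [CharZero k]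
    (h s t : ℕ) (hh : 2 ≤ h)
    (I : Ideal (MvPowerSeries (Fin h) k)) [IsLocalRing (MvPowerSeries (Fin h) k ⧸ I)]
    (hstretched : IsAlmostStretched (MvPowerSeries (Fin h) k ⧸ I))
    (hgor : IsArtinianGorenstein (MvPowerSeries (Fin h) k ⧸ I))
    (htype : HasType (MvPowerSeries (Fin h) k ⧸ I) h s t)
    (hst : 2 * t ≤ s + 1) :
    (IsRegularCouple s t →
      ∃ p : ℕ, p < t ∧ IdealIso I (modelIdeal hh s t p 1)) ∧
    (∀ r : ℕ, IsCritical s t r →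
      (∃ p : ℕ, p < t ∧ p ≠ r ∧ IdealIso I (modelIdeal hh s t p 1)) ∨
      (∃ c : k, c ≠ 0 ∧ IdealIso I (modelIdeal hh s t r (MvPowerSeries.C c))) ∨
      (∃ c : k, c ≠ 0 ∧ ∃ d : ℕ, 1 ≤ d ∧ d + r + 2 ≤ t ∧
        IdealIso I (modelIdeal hh s t r (MvPowerSeries.C c + x₁ k hh ^ d)))) := by
  obtain ⟨p, q, hp, hiso, hq⟩ := exists_idealIso_modelIdeal hh hgor htype
  have hC : ∀ c : k, algebraMap k (MvPowerSeries (Fin h) k) c = MvPowerSeries.C c := fun _ => rfl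
  refine ⟨fun hreg => ?_, fun r hr => ?_⟩
  · rcases hq with ⟨-, rfl⟩ | ⟨hcrit, -⟩
    · rw [map_one] at hiso
      exact ⟨p, hp, hiso⟩
    · exact absurd ⟨p, hcrit⟩ hreg
  · rcases hq with ⟨hcrit, rfl⟩ | ⟨hcrit, c, hc, hq⟩
    · rw [map_one] at hiso
      refine Or.inl ⟨p, hp, ?_, hiso⟩
      rintro rfl
      exact hcrit hr
    · obtain rfl : p = r := by
        have h1 := hcrit.2
        have h2 := hr.2
        omega
      rcases hq with rfl | ⟨d, hd, hdt, rfl⟩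
      · rw [Polynomial.aeval_C, hC] at hiso
        exact Or.inr (Or.inl ⟨c, hc, hiso⟩)
      · rw [map_add, map_pow, Polynomial.aeval_X, Polynomial.aeval_C, hC] at hiso
        exact Or.inr (Or.inr ⟨c, hc, d, hd, hdt, hiso⟩)
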